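/- Let $1\le d<n$ be integers and let $\mathrm{Gr}(d,n)$ be the set of $d$-dimensional linear subspaces of $\mathbb R^n$. For $\delta>0$ and $\sigma\in\mathrm{Gr}(d,n)$ let $$T_\delta(\sigma)=\{\xi\in\mathbb R^n:\ |\Pi_\sigma\xi|\le 1,\ |\Pi_{\sigma^\perp}\xi|<\delta\},$$ where $\Pi_\sigma$ and $\Pi_{\sigma^\perp}$ are the orthogonal projections, and define the $(d,n)$-Nikodym maximal operator by $$\mathcal N_\delta f(x)=\sup_{\sigma\in\mathrm{Gr}(d,n)}\frac1{|T_\delta(\sigma)|}\int_{x+T_\delta(\sigma)}|f(y)|\,dy,\qquad x\in\mathbb R^n.$$ Write $\|\mathcal N_\delta\|_{2\to 2}$ and $\|\mathcal N_\delta\|_{2\to(2,\infty)}$ for the least constants $A\in[0,\infty]$ such that, for all $f\in L^2(\mathbb R^n)$, respectively $\|\mathcal N_\delta f\|_{L^2}\le A\|f\|_{L^2}$ and $\sup_{t>0}t\,|\{\mathcal N_\delta f>t\}|^{1/2}\le A\|f\|_{L^2}$. Then there are constants $c,C>0$, depending only on $d$ and $n$, such that for every $0<\delta\le\frac12$ the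 following hold. 1. (Weak bound and its sharpness) $$c\,w(\delta)\le\|\mathcal N_\delta\|_{2\to(2,\infty)}\le C\,w(\delta),\qquad w(\delta)=\begin{cases}\delta^{-\frac{n-d-1}2},&1\le d<n-1,\\ \sqrt{\log(\delta^{-1})},&d=n-1.\end{cases}$$ 2. (Strong bound and its sharpness up to a factor $\sqrt{\log(\delta^{-1})}$) $$c\,\frac{s(\delta)}{\sqrt{\log(\delta^{-1})}}\le\|\mathcal N_\delta\|_{2\to2}\le C\,s(\delta),\qquad s(\delta)=\begin{cases}\delta^{-\frac{n-d-1}2}\sqrt{\log(\delta^{-1})},&1\le d<n-1,\\ \log(\delta^{-1}),&d=n-1.\end{cases}$$ -/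

import Mathlib

open MeasureTheory
open scoped ENNReal NNReal Pointwise

noncomputable section

/-- The Grassmannian `Gr(d,n)` of `d`-dimensional linear subspaces of `ℝⁿ`. -/
abbrev Gr (d n : ℕ) : Type :=
  {σ : Submodule ℝ (EuclideanSpace ℝ (Fin n)) // Module.finrank ℝ σ = d}

/-- The `δ`-plate `T_δ(σ)`: points whose orthogonal projection on `σ` has norm at most `1` and
whose orthogonal projection on `σᗮ` has norm less than `δ`. -/
def plate {d n : ℕ} (δ : ℝ) (σ : Gr d n) : Set (EuclideanSpace ℝ (Fin n)) :=
  {ξ | ‖σ.1.starProjection ξ‖ ≤ 1 ∧ ‖(σ.1)ᗮ.starProjection ξ‖ < δ}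

/-- The `(d,n)`-Nikodym maximal function: the supremum over `σ ∈ Gr(d,n)` of the averages of `|f|`
over `x + T_δ(σ)`, as an extended nonnegative number. -/
def nikodym (d n : ℕ) (δ : ℝ) (f : EuclideanSpace ℝ (Fin n) → ℂ)
    (x : EuclideanSpace ℝ (Fin n)) : ℝ≥0∞ :=
  ⨆ σ : Gr d n, ⨍⁻ y in x +ᵥ plate δ σ, ‖f y‖ₑ ∂volume

/-- The weak-`L²` quasi-norm `sup_{t > 0} t |{g > t}|^{1/2}` of a nonnegative function. -/
def weakL2Norm {n : ℕ} (g : EuclideanSpace ℝ (Fin n) → ℝ≥0∞) : ℝ≥0∞ :=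
  ⨆ t : ℝ≥0, (t : ℝ≥0∞) * volume {x | (t : ℝ≥0∞) < g x} ^ (1 / 2 : ℝ)

/-- The operator norm of `𝒩_δ : L²(ℝⁿ) → L^{2,∞}(ℝⁿ)`: the least admissible constant. -/
def nikodymWeakNorm (d n : ℕ) (δ : ℝ) : ℝ≥0∞ :=
  sInf {A : ℝ≥0∞ | ∀ f : EuclideanSpace ℝ (Fin n) → ℂ, MemLp f 2 volume →
    weakL2Norm (nikodym d n δ f) ≤ A * eLpNorm f 2 volume}

/-- The operator norm of `𝒩_δ : L²(ℝⁿ) → L²(ℝⁿ)`: the least admissible constant. -/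
def nikodymStrongNorm (d n : ℕ) (δ : ℝ) : ℝ≥0∞ :=
  sInf {A : ℝ≥0∞ | ∀ f : EuclideanSpace ℝ (Fin n) → ℂ, MemLp f 2 volume →
    eLpNorm (nikodym d n δ f) 2 volume ≤ A * eLpNorm f 2 volume}

/-- `δ^{-(n-d-1)/2}` if `d < n - 1`, and `√(log δ⁻¹)` if `d = n - 1`. -/
def weakRate (d n : ℕ) (δ : ℝ) : ℝ :=
  if d + 1 < n then δ ^ (-(((n : ℝ) - d - 1) / 2)) else √(Real.log δ⁻¹)

/-- `δ^{-(n-d-1)/2} √(log δ⁻¹)` if `d < n - 1`, and `log δ⁻¹` if `d = n - 1`. -/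
def strongRate (d n : ℕ) (δ : ℝ) : ℝ :=
  if d + 1 < n then δ ^ (-(((n : ℝ) - d - 1) / 2)) * √(Real.log δ⁻¹) else Real.log δ⁻¹

end

/-! Write `l = n - d - 1`, so that a plate has volume about `δ ^ (l + 1)`.

Weak bound: Córdoba's `L²` argument. Take a maximal `δ`-separated set `S` in a level set, one plate
per point with average above `t`, and apply Cauchy-Schwarz to the sum of the indicators of the
plates. Everything rests on `volume_inter_plate_le`: if the centres of two plates differ by about `2
^ k * δ` in the directions orthogonal to one of them, the plates share volume at most about `δ ^ (l
+ 1) / 2 ^ k`. By packing there are at most about `(2 ^ k * δ) ^ (l + 1) / δ ^ n` such centres, so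
scale `k` contributes a multiple of `2 ^ (k * l)`. Summed up to `2 ^ k ≈ 1 / δ`, this gives `δ ^
(-l)` if `0 < l` and `log δ⁻¹` if `l = 0`: the square of the weak rate.

Strong bound: the operator is local, and on a unit ball its values are at most a power of `δ⁻¹`
times the `L²` norm of `f` on the concentric ball of radius 3. Hence only about `log δ⁻¹` dyadic
levels matter, each costs one weak bound (`setLIntegral_ball_le`), and averaging over the balls
gives the global estimate. This loses `√(log δ⁻¹)`.

Lower bounds: let `V` have dimension `d - 1` and let `f` be a truncated dyadic version of `dist(y,
V) ^ (-(l + 1))`. Every `x` near the origin lies with `V` in some `d`-dimensional subspace, whose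
plate at `x` meets each neighbourhood of `V` in a large set. With `Λ = ∑ (2 ^ k * δ) ^ (-l)`, the
averages are at least about `Λ` and the square of the norm of `f` is at most about `Λ`, so both
operator norms are at least a multiple of `√Λ`. -/

/-! ### Slabs, plates and their volumes. -/

/-- The set of points whose orthogonal projection on `σ` has norm at most `a` and whose orthogonal
projection on `σᗮ` has norm less than `b`. -/
def slab {n : ℕ} (σ : Submodule ℝ (EuclideanSpace ℝ (Fin n))) (a b : ℝ) :
    Set (EuclideanSpace ℝ (Fin n)) :=
  {ξ | ‖σ.starProjection ξ‖ ≤ a ∧ ‖σᗮ.starProjection ξ‖ < b}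

theorem plate_eq_slab {d n : ℕ} (δ : ℝ) (σ : Gr d n) : plate δ σ = slab σ.1 1 δ := rfl

theorem measurableSet_slab {n : ℕ} (σ : Submodule ℝ (EuclideanSpace ℝ (Fin n))) (a b : ℝ) :
    MeasurableSet (slab σ a b) := by
  have h₁ : MeasurableSet {ξ | ‖σ.starProjection ξ‖ ≤ a} :=
    measurableSet_le (by fun_prop) (by fun_prop)
  have h₂ : MeasurableSet {ξ | ‖σᗮ.starProjection ξ‖ < b} :=
    measurableSet_lt (by fun_prop) (by fun_prop)
  exact h₁.inter h₂

theorem measurableSet_vadd_plate {d n : ℕ} (δ : ℝ) (σ : Gr d n) (x : EuclideanSpace ℝ (Fin n)) :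
    MeasurableSet (x +ᵥ plate δ σ) :=
  (measurableSet_slab σ.1 1 δ).const_vadd x

theorem mem_vadd_slab {n : ℕ} {σ : Submodule ℝ (EuclideanSpace ℝ (Fin n))} {a b : ℝ}
    {x y : EuclideanSpace ℝ (Fin n)} : y ∈ x +ᵥ slab σ a b ↔ y - x ∈ slab σ a b := by
  rw [Set.mem_vadd_set_iff_neg_vadd_mem, vadd_eq_add, neg_add_eq_sub]

theorem mem_vadd_plate {d n : ℕ} {δ : ℝ} {σ : Gr d n} {x y : EuclideanSpace ℝ (Fin n)} :
    y ∈ x +ᵥ plate δ σ ↔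
      ‖σ.1.starProjection (y - x)‖ ≤ 1 ∧ ‖(σ.1)ᗮ.starProjection (y - x)‖ < δ :=
  mem_vadd_slab

theorem norm_le_starProjection_add {n : ℕ} (σ : Submodule ℝ (EuclideanSpace ℝ (Fin n)))
    (v : EuclideanSpace ℝ (Fin n)) :
    ‖v‖ ≤ ‖σ.starProjection v‖ + ‖σᗮ.starProjection v‖ := by
  conv_lhs => rw [← Submodule.starProjection_add_starProjection_orthogonal (K := σ) v]
  exact norm_add_le _ _

section boxes

variable {F : Type*} [NormedAddCommGroup F] [InnerProductSpace ℝ F]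

theorem volume_box [MeasurableSpace F] [BorelSpace F] [FiniteDimensional ℝ F]
    {ι : Type*} [Fintype ι] (b : OrthonormalBasis ι ℝ F) {a : ι → ℝ} (ha : ∀ i, 0 ≤ a i) :
    volume {y : F | ∀ i, |inner ℝ (b i) y| ≤ a i} = ENNReal.ofReal (∏ i, 2 * a i) := by
  have h := (PiLp.volume_preserving_ofLp ι).comp b.measurePreserving_repr
  have hs : {y : F | ∀ i, |inner ℝ (b i) y| ≤ a i} =
      (WithLp.ofLp ∘ b.repr) ⁻¹' Set.Icc (fun i => -a i) a := by
    ext y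
    simp [Set.mem_Icc, Pi.le_def, abs_le, forall_and, OrthonormalBasis.repr_apply_apply]
  rw [hs, h.measure_preimage measurableSet_Icc.nullMeasurableSet, Real.volume_Icc_pi,
    ENNReal.ofReal_prod_of_nonneg (fun i _ => by linarith [ha i])]
  exact Finset.prod_congr rfl fun i _ => by congr 1; ring

theorem norm_starProjection_le_of_basis [FiniteDimensional ℝ F] {ι : Type*} [Fintype ι]
    (b : OrthonormalBasis ι ℝ F) (σ : Submodule ℝ F) (hb : ∀ i, b i ∈ σ ∨ b i ∈ σᗮ) {ξ : F} {r : ℝ}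
    (hr : 0 ≤ r) (h : ∀ i, b i ∈ σ → |inner ℝ (b i) ξ| ≤ r) :
    ‖σ.starProjection ξ‖ ≤ Fintype.card ι * r := by
  rw [← b.sum_repr' (σ.starProjection ξ)]
  refine (norm_sum_le _ _).trans ?_
  have : ∀ i ∈ Finset.univ, ‖inner ℝ (b i) (σ.starProjection ξ) • b i‖ ≤ r := by
    intro i _
    rw [norm_smul, b.norm_eq_one, mul_one, Real.norm_eq_abs,
      ← Submodule.inner_starProjection_left_eq_right]
    rcases hb i with hi | hi
    · rw [Submodule.starProjection_eq_self_iff.2 hi]; exact h i hi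
    · rw [(Submodule.starProjection_apply_eq_zero_iff σ).2 hi]; simpa using hr
  exact (Finset.sum_le_sum this).trans (by simp)

theorem abs_inner_le_norm_starProjection [FiniteDimensional ℝ F] {σ : Submodule ℝ F} {u : F}
    (hu : u ∈ σ) (h1 : ‖u‖ = 1) (ξ : F) : |inner ℝ u ξ| ≤ ‖σ.starProjection ξ‖ := by
  rw [← Submodule.starProjection_eq_self_iff.2 hu, Submodule.inner_starProjection_left_eq_right]
  simpa [h1] using abs_real_inner_le_norm u (σ.starProjection ξ)

theorem exists_orthonormalBasis_adapted [FiniteDimensional ℝ F] (σ : Submodule ℝ F) {d m : ℕ}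
    (hσ : Module.finrank ℝ σ = d) (hdm : d + m = Module.finrank ℝ F) :
    ∃ b : OrthonormalBasis (Fin d ⊕ Fin m) ℝ F,
      (∀ i, b (.inl i) ∈ σ) ∧ ∀ j, b (.inr j) ∈ σᗮ := by
  have hσ' : Module.finrank ℝ σᗮ = m := by
    have := σ.finrank_add_finrank_orthogonal; omega
  let b₁ := (stdOrthonormalBasis ℝ σ).reindex (finCongr hσ)
  let b₂ := (stdOrthonormalBasis ℝ σᗮ).reindex (finCongr hσ')
  let v : Fin d ⊕ Fin m → F := Sum.elim (fun i => (b₁ i : F)) (fun j => (b₂ j : F))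
  have hv : Orthonormal ℝ v := by
    classical
    rw [orthonormal_iff_ite]
    rintro (i | i) (j | j)
    · simpa [v] using (orthonormal_iff_ite.1 b₁.orthonormal) i j
    · simpa [v] using Submodule.inner_right_of_mem_orthogonal (b₁ i).2 (b₂ j).2
    · simpa [v] using Submodule.inner_left_of_mem_orthogonal (b₁ j).2 (b₂ i).2
    · simpa [v] using (orthonormal_iff_ite.1 b₂.orthonormal) i j
  obtain ⟨b, hb⟩ := Orthonormal.exists_orthonormalBasis_extension_of_card_eq
    (ι := Fin d ⊕ Fin m) (𝕜 := ℝ) (by simp [hdm]) (v := v) (s := Set.univ)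
    (hv.comp _ Subtype.val_injective)
  refine ⟨b, fun i => ?_, fun j => ?_⟩
  · rw [hb _ trivial]; exact (b₁ i).2
  · rw [hb _ trivial]; exact (b₂ j).2

end boxes

theorem volume_slab_le {n d m : ℕ} (hn : d + m = n) {σ : Submodule ℝ (EuclideanSpace ℝ (Fin n))}
    (hσ : Module.finrank ℝ σ = d) {a b : ℝ} (ha : 0 ≤ a) (hb : 0 ≤ b) :
    volume (slab σ a b) ≤ ENNReal.ofReal (2 ^ n * a ^ d * b ^ m) := by
  obtain ⟨e, h1, h2⟩ := exists_orthonormalBasis_adapted σ hσ (m := m) (by simpa using hn)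
  have hbox := volume_box e (a := Sum.elim (fun _ => a) (fun _ => b))
    (by rintro (i | i) <;> simpa)
  have hp : ∏ i, 2 * Sum.elim (fun _ : Fin d => a) (fun _ : Fin m => b) i
      = 2 ^ n * a ^ d * b ^ m := by
    simp [Fintype.prod_sum_type, mul_pow, ← hn, pow_add]; ring
  rw [← hp, ← hbox]
  refine measure_mono fun ξ hξ => ?_
  rintro (i | i)
  · exact (abs_inner_le_norm_starProjection (h1 i) (e.norm_eq_one _) ξ).trans hξ.1
  · exact (abs_inner_le_norm_starProjection (h2 i) (e.norm_eq_one _) ξ).trans hξ.2.le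

theorem le_volume_slab_one {n d m : ℕ} (hn : d + m = n) (hn0 : 0 < n)
    {σ : Submodule ℝ (EuclideanSpace ℝ (Fin n))}
    (hσ : Module.finrank ℝ σ = d) {δ : ℝ} (hδ : 0 < δ) :
    ENNReal.ofReal ((1 / n) ^ n * δ ^ m) ≤ volume (slab σ 1 δ) := by
  obtain ⟨e, h1, h2⟩ := exists_orthonormalBasis_adapted σ hσ (m := m) (by simpa using hn)
  have hn' : (0 : ℝ) < n := by exact_mod_cast hn0
  -- A projection is bounded by the sum of at most `n` coordinates, hence the division by `n`; the
  -- further factor 2 makes the bound by `δ` strict.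
  have hbox := volume_box e (a := Sum.elim (fun _ => 1 / (2 * n)) (fun _ => δ / (2 * n)))
    (by rintro (i | i) <;> simp <;> positivity)
  have hp : ∏ i, 2 * Sum.elim (fun _ : Fin d => 1 / (2 * (n : ℝ))) (fun _ : Fin m => δ / (2 * n)) i
      = (1 / n) ^ n * δ ^ m := by
    have e1 : 2 * (1 / (2 * (n : ℝ))) = 1 / n := by field_simp
    have e2 : 2 * (δ / (2 * (n : ℝ))) = 1 / n * δ := by field_simp
    simp only [Fintype.prod_sum_type, Sum.elim_inl, Sum.elim_inr, e1, e2, Finset.prod_const,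
      Finset.card_univ, Fintype.card_fin, mul_pow]
    conv_rhs => rw [← hn, pow_add]
    rw [hn]; ring
  rw [← hp, ← hbox]
  have hadapt : ∀ i, e i ∈ σ ∨ e i ∈ σᗮ := by
    rintro (i | i)
    exacts [.inl (h1 i), .inr (h2 i)]
  have hcard : (Fintype.card (Fin d ⊕ Fin m) : ℝ) = n := by simp [← hn]
  have hdisj : ∀ i, e i ∈ σ → e i ∈ σᗮ → False := fun i ha hb => by
    have := Submodule.inner_right_of_mem_orthogonal ha hb
    simp at this
  refine measure_mono fun ξ hξ => ⟨?_, ?_⟩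
  · refine (norm_starProjection_le_of_basis e σ hadapt (r := 1 / (2 * n)) (by positivity) ?_).trans ?_
    · rintro (i | i) hi
      · exact hξ (.inl i)
      · exact (hdisj _ hi (h2 i)).elim
    · rw [hcard]; field_simp; norm_num
  · refine (norm_starProjection_le_of_basis e σᗮ (r := δ / (2 * n)) ?_ (by positivity) ?_).trans_lt ?_
    · intro i; rw [Submodule.orthogonal_orthogonal]; exact (hadapt i).symm
    · rintro (i | i) hi
      · exact (hdisj _ (h1 i) hi).elim
      · exact hξ (.inr i)
    · rw [hcard]; field_simp; norm_num

theorem volume_vadd_plate_le {d n m : ℕ} (hn : d + m = n) {δ : ℝ} (hδ : 0 < δ) (σ : Gr d n)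
    (x : EuclideanSpace ℝ (Fin n)) :
    volume (x +ᵥ plate δ σ) ≤ ENNReal.ofReal (2 ^ n * δ ^ m) := by
  rw [measure_vadd, plate_eq_slab]
  simpa using volume_slab_le hn σ.2 zero_le_one hδ.le

theorem le_volume_vadd_plate {d n m : ℕ} (hn : d + m = n) (hn0 : 0 < n) {δ : ℝ} (hδ : 0 < δ)
    (σ : Gr d n) (x : EuclideanSpace ℝ (Fin n)) :
    ENNReal.ofReal ((1 / n) ^ n * δ ^ m) ≤ volume (x +ᵥ plate δ σ) := by
  rw [measure_vadd, plate_eq_slab]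
  exact le_volume_slab_one hn hn0 σ.2 hδ

/-! ### Overlap of plates and packing of their centres. -/

/-- If the plates meet although their centres are far apart across `σ`, then `τ` contains a vector
`u` of norm at most 1 that is long across `σ`. Translates of the intersection by small multiples of
`u` leave the thin `σ`-plate and become disjoint, yet remain in a plate along `τ` of doubled length.
Comparing volumes gives the gain `2 ^ k`. For `k < 3` the volume of one plate suffices. -/
theorem volume_inter_plate_le {d n m : ℕ} (hn : d + m = n) {δ : ℝ} (hδ : 0 < δ) (σ τ : Gr d n)
    (x x' : EuclideanSpace ℝ (Fin n)) (k : ℕ)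
    (hk : k = 0 ∨ 2 ^ (k - 1) * δ ≤ ‖(σ.1)ᗮ.starProjection (x' - x)‖) :
    volume ((x +ᵥ plate δ σ) ∩ (x' +ᵥ plate δ τ)) ≤
      ENNReal.ofReal (8 * 2 ^ d * 2 ^ n * δ ^ m / 2 ^ k) := by
  rcases lt_or_ge k 3 with hk3 | hk3
  · refine ((measure_mono Set.inter_subset_left).trans
      (volume_vadd_plate_le hn hδ σ x)).trans (ENNReal.ofReal_le_ofReal ?_)
    rw [le_div_iff₀ (by positivity)]
    have h1 : (2 : ℝ) ^ k ≤ 2 ^ 3 := pow_le_pow_right₀ (by norm_num) hk3.le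
    have h2 : (1 : ℝ) ≤ 2 ^ d := one_le_pow₀ (by norm_num)
    have h3 : (2 : ℝ) ^ k ≤ 8 * 2 ^ d := by linarith
    calc 2 ^ n * δ ^ m * 2 ^ k ≤ 2 ^ n * δ ^ m * (8 * 2 ^ d) := by gcongr
      _ = _ := by ring
  obtain ⟨j, rfl⟩ : ∃ j, k = j + 3 := ⟨k - 3, by omega⟩
  replace hk : 2 ^ (j + 2) * δ ≤ ‖(σ.1)ᗮ.starProjection (x' - x)‖ := by simpa using hk
  set D := (x +ᵥ plate δ σ) ∩ (x' +ᵥ plate δ τ) with hD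
  rcases D.eq_empty_or_nonempty with h0 | ⟨p, hp1, hp2⟩
  · simp [h0]
  rw [mem_vadd_plate] at hp1 hp2
  set u := (τ.1).starProjection (x' - p) with hu
  have huτ : u ∈ τ.1 := Submodule.starProjection_apply_mem _ _
  have hneg : x' - p = -(p - x') := by abel
  have hu1 : ‖u‖ ≤ 1 := by rw [hu, hneg, map_neg, norm_neg]; exact hp2.1
  -- Replacing `x' - x` by `u` costs less than `2 * δ` across `σ`, which halves the lower bound at
  -- worst.
  have hproj : 2 ^ (j + 1) * δ ≤ ‖(σ.1)ᗮ.starProjection u‖ := by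
    have e1 : x' - x = u + (τ.1)ᗮ.starProjection (x' - p) + (p - x) := by
      rw [hu, Submodule.starProjection_add_starProjection_orthogonal]; abel
    have e2 : ‖(σ.1)ᗮ.starProjection ((τ.1)ᗮ.starProjection (x' - p))‖ < δ := by
      refine (Submodule.norm_starProjection_apply_le _ _).trans_lt ?_
      rw [hneg, map_neg, norm_neg]; exact hp2.2
    rw [e1, map_add, map_add] at hk
    have e3 := hk.trans (norm_add₃_le)
    have e4 : (1 : ℝ) ≤ 2 ^ j := one_le_pow₀ (by norm_num)
    have e5 : δ ≤ 2 ^ j * δ := by nlinarith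
    rw [pow_add] at e3 ⊢
    nlinarith [hp1.2]
  have hDm : MeasurableSet D :=
    (measurableSet_vadd_plate δ σ x).inter (measurableSet_vadd_plate δ τ x')
  have hs0 : (0 : ℝ) < 1 / 2 ^ j := by positivity
  -- Each step moves by at least `2 * δ` across `σ`, the full width of the plate, while `2 ^ j`
  -- steps move by at most 1 along `τ`.
  let w : ℕ → EuclideanSpace ℝ (Fin n) := fun i => ((i : ℝ) * (1 / 2 ^ j)) • u
  have hdisj : ((Finset.range (2 ^ j) : Finset ℕ) : Set ℕ).PairwiseDisjoint
      (fun i => w i +ᵥ D) := by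
    intro a _ b _ hab
    refine Set.disjoint_left.2 fun y hy1 hy2 => ?_
    rw [Set.mem_vadd_set_iff_neg_vadd_mem] at hy1 hy2
    have q1 := (mem_vadd_plate.1 hy1.1).2
    have q2 := (mem_vadd_plate.1 hy2.1).2
    have e1 : ((-w a +ᵥ y) - x) - ((-w b +ᵥ y) - x) = (((b : ℝ) - a) * (1 / 2 ^ j)) • u := by
      simp only [w, vadd_eq_add, sub_mul, sub_smul]; abel
    have e2 : ‖(σ.1)ᗮ.starProjection (((-w a +ᵥ y) - x) - ((-w b +ᵥ y) - x))‖ < δ + δ := by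
      rw [map_sub]; exact (norm_sub_le _ _).trans_lt (add_lt_add q1 q2)
    rw [e1, map_smul, norm_smul, Real.norm_eq_abs, abs_mul, abs_of_pos hs0] at e2
    have e3 : (1 : ℝ) ≤ |(b : ℝ) - a| := by
      have : (1 : ℤ) ≤ |(b : ℤ) - a| := Int.one_le_abs (by omega)
      exact_mod_cast this
    have e4 : 1 * (1 / 2 ^ j) * (2 ^ (j + 1) * δ) ≤
        |(b : ℝ) - a| * (1 / 2 ^ j) * ‖(σ.1)ᗮ.starProjection u‖ := by gcongr
    have e5 : 1 * (1 / 2 ^ j) * (2 ^ (j + 1) * δ) = 2 * δ := by field_simp; ring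
    linarith
  have hsub : (⋃ i ∈ Finset.range (2 ^ j), (w i +ᵥ D)) ⊆ x' +ᵥ slab τ.1 2 δ := by
    refine Set.iUnion₂_subset fun i hi y hy => ?_
    rw [Set.mem_vadd_set_iff_neg_vadd_mem] at hy
    obtain ⟨q1, q2⟩ := mem_vadd_plate.1 hy.2
    have hwτ : w i ∈ τ.1 := τ.1.smul_mem _ huτ
    have e1 : y - x' = w i + ((-w i +ᵥ y) - x') := by simp only [vadd_eq_add]; abel
    rw [mem_vadd_slab]
    constructor
    · rw [e1, map_add, Submodule.starProjection_eq_self_iff.2 hwτ]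
      refine (norm_add_le _ _).trans ?_
      have : ‖w i‖ ≤ 1 := by
        have hi' : (i : ℝ) ≤ 2 ^ j := by exact_mod_cast (Finset.mem_range.1 hi).le
        rw [norm_smul, Real.norm_of_nonneg (by positivity)]
        calc (i : ℝ) * (1 / 2 ^ j) * ‖u‖ ≤ 2 ^ j * (1 / 2 ^ j) * 1 := by gcongr
          _ = 1 := by field_simp
      linarith
    · rw [e1, map_add, (Submodule.starProjection_apply_eq_zero_iff _).2
        (Submodule.le_orthogonal_orthogonal _ hwτ), zero_add]
      exact q2
  have hvol := measure_mono (μ := volume) hsub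
  rw [measure_biUnion_finset hdisj (fun i _ => hDm.const_vadd _), measure_vadd] at hvol
  simp only [measure_vadd, Finset.sum_const, Finset.card_range, nsmul_eq_mul] at hvol
  have hfin := hvol.trans (volume_slab_le hn τ.2 zero_le_two hδ.le)
  have hpos : (0 : ℝ) < 2 ^ j := by positivity
  have hcast : ((2 ^ j : ℕ) : ℝ≥0∞) = ENNReal.ofReal (2 ^ j) := by
    rw [ENNReal.ofReal_pow zero_le_two]; simp
  rw [hcast, mul_comm] at hfin
  refine (ENNReal.le_div_iff_mul_le (by simp) (by simp)).2 hfin |>.trans ?_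
  rw [← ENNReal.ofReal_div_of_pos hpos]
  refine ENNReal.ofReal_le_ofReal (le_of_eq ?_)
  rw [pow_add]; field_simp; norm_num

/-- The volume of the unit ball of `ℝⁿ`, as a real number. -/
noncomputable def unitBallVolume (n : ℕ) : ℝ :=
  volume.real (Metric.ball (0 : EuclideanSpace ℝ (Fin n)) 1)

theorem unitBallVolume_pos (n : ℕ) : 0 < unitBallVolume n :=
  ENNReal.toReal_pos (Metric.measure_ball_pos volume _ one_pos).ne' measure_ball_lt_top.ne

theorem volume_ball_eq {n : ℕ} (x : EuclideanSpace ℝ (Fin n)) {r : ℝ} (hr : 0 < r) :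
    volume (Metric.ball x r) = ENNReal.ofReal (r ^ n * unitBallVolume n) := by
  rw [Measure.addHaar_ball_of_pos _ _ hr, finrank_euclideanSpace_fin,
    ENNReal.ofReal_mul (by positivity), unitBallVolume, Measure.real,
    ENNReal.ofReal_toReal measure_ball_lt_top.ne]

/-- Balls of radius `δ / 2` about the points are disjoint and fit in a slightly enlarged slab. -/
theorem card_le_of_separated {d n m : ℕ} (hn : d + m = n) {δ : ℝ} (hδ : 0 < δ) (hδ1 : δ ≤ 1)
    (σ : Gr d n) (x : EuclideanSpace ℝ (Fin n)) (k : ℕ) (S : Finset (EuclideanSpace ℝ (Fin n)))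
    (hsep : ∀ p ∈ S, ∀ q ∈ S, p ≠ q → δ ≤ dist p q)
    (hS : ∀ p ∈ S, ‖p - x‖ ≤ 3 ∧ ‖(σ.1)ᗮ.starProjection (p - x)‖ < 2 ^ k * δ) :
    (S.card : ℝ) * ((δ / 2) ^ n * unitBallVolume n) ≤ 2 ^ n * 4 ^ d * (2 ^ (k + 1) * δ) ^ m := by
  have hdisj : (S : Set (EuclideanSpace ℝ (Fin n))).PairwiseDisjoint
      (fun p => Metric.ball p (δ / 2)) := fun p hp q hq hpq =>
    Metric.ball_disjoint_ball (by linarith [hsep p hp q hq hpq])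
  have hsub : (⋃ p ∈ S, Metric.ball p (δ / 2)) ⊆ x +ᵥ slab σ.1 4 (2 ^ (k + 1) * δ) := by
    refine Set.iUnion₂_subset fun p hp y hy => ?_
    rw [Metric.mem_ball, dist_eq_norm] at hy
    obtain ⟨h1, h2⟩ := hS p hp
    have e : y - x = (y - p) + (p - x) := by abel
    rw [mem_vadd_slab]
    constructor
    · refine (Submodule.norm_starProjection_apply_le _ _).trans ?_
      rw [e]; exact (norm_add_le _ _).trans (by linarith)
    · rw [e, map_add]
      refine (norm_add_le _ _).trans_lt ?_
      have := (Submodule.norm_starProjection_apply_le (σ.1)ᗮ (y - p))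
      have e4 : (1 : ℝ) ≤ 2 ^ k := one_le_pow₀ (by norm_num)
      rw [pow_succ]
      nlinarith
  have hvol := measure_mono (μ := volume) hsub
  rw [measure_biUnion_finset hdisj (fun i _ => measurableSet_ball), measure_vadd] at hvol
  have hfin := hvol.trans (volume_slab_le hn σ.2 (by norm_num) (by positivity))
  simp only [volume_ball_eq _ (half_pos hδ), Finset.sum_const, nsmul_eq_mul] at hfin
  rw [← ENNReal.ofReal_natCast, ← ENNReal.ofReal_mul (by positivity),
    ENNReal.ofReal_le_ofReal_iff (by positivity)] at hfin
  exact hfin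

/-- The centres `q` are sorted by dyadic distance from `p` across `σ p`; at each scale the overlap
bound is multiplied by the packing count. -/
theorem sum_volume_inter_plate_le {d n l : ℕ} (hn : d + (l + 1) = n) {δ : ℝ} (hδ : 0 < δ)
    (hδ1 : δ ≤ 1 / 2) {K : ℕ} (hK : 3 < 2 ^ K * δ) (S : Finset (EuclideanSpace ℝ (Fin n)))
    (hsep : ∀ p ∈ S, ∀ q ∈ S, p ≠ q → δ ≤ dist p q)
    (σ : EuclideanSpace ℝ (Fin n) → Gr d n) (p : EuclideanSpace ℝ (Fin n)) :
    ∑ q ∈ S, volume.real ((p +ᵥ plate δ (σ p)) ∩ (q +ᵥ plate δ (σ q))) ≤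
      (8 * 2 ^ d * 2 ^ n * (2 ^ n * 4 ^ d * 2 ^ (l + 1) * 2 ^ n) / unitBallVolume n) *
        ((δ ^ (l + 1)) ^ 2 / δ ^ n) * ∑ k ∈ Finset.range (K + 1), ((2 : ℝ) ^ l) ^ k := by
  classical
  have hβ := unitBallVolume_pos n
  set C₁ : ℝ := 8 * 2 ^ d * 2 ^ n with hC₁
  let Sk : ℕ → Finset (EuclideanSpace ℝ (Fin n)) := fun k =>
    S.filter fun q => ‖q - p‖ ≤ 3 ∧ ‖((σ p).1)ᗮ.starProjection (q - p)‖ < 2 ^ k * δ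
  have hterm : ∀ q ∈ S, volume.real ((p +ᵥ plate δ (σ p)) ∩ (q +ᵥ plate δ (σ q))) ≤
      ∑ k ∈ Finset.range (K + 1), if q ∈ Sk k then C₁ * δ ^ (l + 1) / 2 ^ k else 0 := by
    intro q hq
    have hnonneg : ∀ k ∈ Finset.range (K + 1),
        0 ≤ if q ∈ Sk k then C₁ * δ ^ (l + 1) / 2 ^ k else 0 := by
      intro k _; split_ifs <;> positivity
    rcases ((p +ᵥ plate δ (σ p)) ∩ (q +ᵥ plate δ (σ q))).eq_empty_or_nonempty with h0 | ⟨y, h1, h2⟩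
    · rw [h0]; simpa using Finset.sum_nonneg hnonneg
    -- A point of a plate lies within `1 + δ ≤ 3 / 2` of its centre. Hence scales with `2 ^ k * δ`
    -- beyond 3 are not needed.
    have hd : ‖q - p‖ ≤ 3 := by
      rw [mem_vadd_plate] at h1 h2
      have e1 := norm_le_starProjection_add (σ p).1 (y - p)
      have e2 := norm_le_starProjection_add (σ q).1 (y - q)
      have e3 : q - p = (y - p) - (y - q) := by abel
      rw [e3]
      refine (norm_sub_le _ _).trans ?_
      linarith [h1.1, h1.2, h2.1, h2.2]
    have hex : ∃ k : ℕ, ‖((σ p).1)ᗮ.starProjection (q - p)‖ < 2 ^ k * δ :=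
      ⟨K, ((Submodule.norm_starProjection_apply_le _ _).trans hd).trans_lt hK⟩
    -- The least admissible scale: its minimality is the lower bound on the separation required by
    -- the overlap estimate, unless `k = 0`.
    let k := Nat.find hex
    have hkK : k ≤ K := Nat.find_min' hex
      (((Submodule.norm_starProjection_apply_le _ _).trans hd).trans_lt hK)
    have hkmem : q ∈ Sk k := by
      simp only [Sk, Finset.mem_filter]; exact ⟨hq, hd, Nat.find_spec hex⟩
    have hk : k = 0 ∨ 2 ^ (k - 1) * δ ≤ ‖((σ p).1)ᗮ.starProjection (q - p)‖ := by
      rcases Nat.eq_zero_or_pos k with h | h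
      · exact .inl h
      · exact .inr (not_lt.1 (Nat.find_min hex (m := k - 1) (Nat.sub_lt h one_pos)))
    refine le_trans ?_ (Finset.single_le_sum hnonneg (Finset.mem_range.2 (Nat.lt_succ_of_le hkK)))
    rw [if_pos hkmem]
    exact ENNReal.toReal_le_of_le_ofReal (by positivity)
      (volume_inter_plate_le hn hδ (σ p) (σ q) p q k hk)
  refine (Finset.sum_le_sum hterm).trans ?_
  rw [Finset.sum_comm, Finset.mul_sum]
  refine Finset.sum_le_sum fun k _ => ?_
  have hcard := card_le_of_separated hn hδ (by linarith) (σ p) p k (Sk k)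
    (fun a ha b hb => hsep a (Finset.mem_filter.1 ha).1 b (Finset.mem_filter.1 hb).1)
    (fun a ha => (Finset.mem_filter.1 ha).2)
  rw [← le_div_iff₀ (by positivity)] at hcard
  have hsum : (∑ q ∈ S, if q ∈ Sk k then C₁ * δ ^ (l + 1) / 2 ^ k else 0) =
      (Sk k).card * (C₁ * δ ^ (l + 1) / 2 ^ k) := by
    rw [← Finset.sum_filter, Finset.sum_const, nsmul_eq_mul]
    congr 3
    ext q; simp only [Sk, Finset.mem_filter]; tauto
  rw [hsum]
  refine (mul_le_mul_of_nonneg_right hcard (by positivity)).trans (le_of_eq ?_)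
  have e1 : ((2 : ℝ) ^ (k + 1) * δ) ^ (l + 1) = 2 ^ (l + 1) * (2 ^ l) ^ k * 2 ^ k * δ ^ (l + 1) := by
    rw [mul_pow, ← pow_mul, ← pow_mul, ← pow_add, ← pow_add]; congr 2; ring
  rw [e1, div_pow]
  field_simp

/-! ### The weak bound. -/

/-- Cauchy-Schwarz for `g` against the sum `G` of the indicators; expanding `G ^ 2` produces the
pairwise overlaps. -/
theorem sq_sum_setLIntegral_le {α ι : Type*} [MeasurableSpace α] {μ : Measure α} (S : Finset ι)
    {A : ι → Set α} (hA : ∀ i, MeasurableSet (A i)) {g : α → ℝ≥0∞} (hg : AEMeasurable g μ) :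
    (∑ i ∈ S, ∫⁻ y in A i, g y ∂μ) ^ 2 ≤
      (∫⁻ y, g y ^ 2 ∂μ) * ∑ i ∈ S, ∑ j ∈ S, μ (A i ∩ A j) := by
  let G : α → ℝ≥0∞ := fun y => ∑ i ∈ S, (A i).indicator 1 y
  have hG : Measurable G := Finset.measurable_fun_sum _ fun i _ => measurable_one.indicator (hA i)
  have h1 : ∑ i ∈ S, ∫⁻ y in A i, g y ∂μ = ∫⁻ y, (g * G) y ∂μ := by
    have : ∀ y, (g * G) y = ∑ i ∈ S, (A i).indicator g y := fun y => by
      simp only [Pi.mul_apply, G, Finset.mul_sum]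
      refine Finset.sum_congr rfl fun i _ => ?_
      by_cases h : y ∈ A i <;> simp [h]
    simp_rw [this]
    rw [lintegral_finsetSum' _ fun i _ => hg.indicator (hA i)]
    exact Finset.sum_congr rfl fun i _ => (lintegral_indicator (hA i) _).symm
  have h2 : ∫⁻ y, G y ^ 2 ∂μ = ∑ i ∈ S, ∑ j ∈ S, μ (A i ∩ A j) := by
    have : ∀ y, G y ^ 2 = ∑ i ∈ S, ∑ j ∈ S, (A i ∩ A j).indicator 1 y := fun y => by
      simp only [G, sq, Finset.sum_mul_sum]
      refine Finset.sum_congr rfl fun i _ => Finset.sum_congr rfl fun j _ => ?_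
      by_cases h : y ∈ A i <;> by_cases h' : y ∈ A j <;> simp [h, h']
    simp_rw [this]
    rw [lintegral_finsetSum _ fun i _ => Finset.measurable_fun_sum _ fun j _ =>
      measurable_one.indicator ((hA i).inter (hA j))]
    refine Finset.sum_congr rfl fun i _ => ?_
    rw [lintegral_finsetSum _ fun j _ => measurable_one.indicator ((hA i).inter (hA j))]
    exact Finset.sum_congr rfl fun j _ => lintegral_indicator_one ((hA i).inter (hA j))
  have h3 := ENNReal.lintegral_mul_le_Lp_mul_Lq μ Real.HolderConjugate.two_two hg hG.aemeasurable
  simp only [ENNReal.rpow_two] at h3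
  rw [h1, ← h2]
  refine (pow_le_pow_left₀ (zero_le) h3 2).trans (le_of_eq ?_)
  rw [mul_pow, ← ENNReal.rpow_two, ← ENNReal.rpow_two, ← ENNReal.rpow_mul, ← ENNReal.rpow_mul]
  norm_num

theorem lintegral_enorm_sq_eq {α F : Type*} [MeasurableSpace α] [ENorm F]
    {μ : Measure α} (f : α → F) : ∫⁻ y, ‖f y‖ₑ ^ 2 ∂μ = eLpNorm f 2 μ ^ 2 := by
  rw [eLpNorm_eq_lintegral_rpow_enorm_toReal two_ne_zero ENNReal.ofNat_ne_top,
    ← ENNReal.rpow_two, ← ENNReal.rpow_mul]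
  norm_num

theorem mul_volume_le_of_lt_laverage {α : Type*} [MeasurableSpace α] {μ : Measure α} {s : Set α}
    {g : α → ℝ≥0∞} {t : ℝ≥0∞} (h : t < ⨍⁻ y in s, g y ∂μ) : t * μ s ≤ ∫⁻ y in s, g y ∂μ := by
  rw [setLAverage_eq] at h
  exact ENNReal.mul_le_of_le_div h.le

/-- The constant in the weak-type estimate, before the sum over scales. -/
noncomputable def weakConst (d n l : ℕ) : ℝ :=
  8 * 2 ^ d * 2 ^ n * (2 ^ n * 4 ^ d * 2 ^ (l + 1) * 2 ^ n) / unitBallVolume n /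
    ((1 / n) ^ n) ^ 2

theorem weakConst_pos {d n l : ℕ} (hn0 : 0 < n) : 0 < weakConst d n l := by
  have := unitBallVolume_pos n
  have : (0 : ℝ) < n := by exact_mod_cast hn0
  unfold weakConst; positivity

/-- A discrete weak-type estimate. Cauchy-Schwarz bounds the square of `N * t * δ ^ (l + 1)` by the
overlap sum, which is linear in `N`, so one factor `N` cancels. -/
theorem card_mul_sq_le {d n l : ℕ} (hn : d + (l + 1) = n) {δ : ℝ} (hδ : 0 < δ)
    (hδ1 : δ ≤ 1 / 2) {K : ℕ} (hK : 3 < 2 ^ K * δ) (S : Finset (EuclideanSpace ℝ (Fin n)))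
    (hsep : ∀ p ∈ S, ∀ q ∈ S, p ≠ q → δ ≤ dist p q)
    (σ : EuclideanSpace ℝ (Fin n) → Gr d n) {f : EuclideanSpace ℝ (Fin n) → ℂ}
    (hf : MemLp f 2 volume) (t : ℝ≥0)
    (ht : ∀ p ∈ S, (t : ℝ≥0∞) < ⨍⁻ y in p +ᵥ plate δ (σ p), ‖f y‖ₑ ∂volume) :
    (S.card : ℝ) * t ^ 2 * δ ^ n ≤
      weakConst d n l * (∑ k ∈ Finset.range (K + 1), ((2 : ℝ) ^ l) ^ k) *
        (eLpNorm f 2 volume).toReal ^ 2 := by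
  have hn0 : 0 < n := by omega
  have hn0' : (0 : ℝ) < n := by exact_mod_cast hn0
  have hβ := unitBallVolume_pos n
  rcases S.eq_empty_or_nonempty with rfl | hne
  · have := weakConst_pos (d := d) (l := l) hn0
    simp only [Finset.card_empty, Nat.cast_zero, zero_mul]; positivity
  obtain ⟨N, hN⟩ : ∃ N : ℝ, N = S.card := ⟨_, rfl⟩
  have hcard : 0 < N := by rw [hN]; exact_mod_cast hne.card_pos
  rw [← hN]
  obtain ⟨F, hF0, hFe⟩ : ∃ F : ℝ, 0 ≤ F ∧ eLpNorm f 2 volume = ENNReal.ofReal F :=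
    ⟨_, ENNReal.toReal_nonneg, (ENNReal.ofReal_toReal hf.2.ne).symm⟩
  rw [hFe, ENNReal.toReal_ofReal hF0]
  have hcs := sq_sum_setLIntegral_le (μ := volume) S
    (A := fun p => p +ᵥ plate δ (σ p)) (fun p => measurableSet_vadd_plate δ (σ p) p)
    hf.1.enorm
  rw [lintegral_enorm_sq_eq, hFe] at hcs
  have hlow : ENNReal.ofReal (N * (t * ((1 / n) ^ n * δ ^ (l + 1)))) ≤
      ∑ p ∈ S, ∫⁻ y in p +ᵥ plate δ (σ p), ‖f y‖ₑ := by
    rw [ENNReal.ofReal_mul hcard.le, hN, ENNReal.ofReal_natCast, ← nsmul_eq_mul]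
    refine Finset.card_nsmul_le_sum _ _ _ fun p hp => ?_
    refine le_trans ?_ (mul_volume_le_of_lt_laverage (ht p hp))
    rw [ENNReal.ofReal_mul (by positivity), ENNReal.ofReal_coe_nnreal]
    gcongr
    exact le_volume_vadd_plate hn hn0 hδ (σ p) p
  set B := (8 * 2 ^ d * 2 ^ n * (2 ^ n * 4 ^ d * 2 ^ (l + 1) * 2 ^ n) / unitBallVolume n) *
        ((δ ^ (l + 1)) ^ 2 / δ ^ n) * ∑ k ∈ Finset.range (K + 1), ((2 : ℝ) ^ l) ^ k with hB
  have hB0 : 0 ≤ B := by positivity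
  have hup : ∑ p ∈ S, ∑ q ∈ S, volume ((p +ᵥ plate δ (σ p)) ∩ (q +ᵥ plate δ (σ q))) ≤
      ENNReal.ofReal (N * B) := by
    rw [ENNReal.ofReal_mul hcard.le, hN, ENNReal.ofReal_natCast, ← nsmul_eq_mul]
    refine Finset.sum_le_card_nsmul _ _ _ fun p hp => ?_
    have hfin : ∀ q, volume ((p +ᵥ plate δ (σ p)) ∩ (q +ᵥ plate δ (σ q))) ≠ ∞ := fun q =>
      ((measure_mono Set.inter_subset_left).trans_lt
        ((volume_vadd_plate_le hn hδ (σ p) p).trans_lt ENNReal.ofReal_lt_top)).ne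
    have := ENNReal.ofReal_le_ofReal
      (sum_volume_inter_plate_le hn hδ hδ1 hK S hsep σ p)
    rw [ENNReal.ofReal_sum_of_nonneg (fun _ _ => measureReal_nonneg)] at this
    refine le_trans (le_of_eq (Finset.sum_congr rfl fun q _ => ?_)) this
    exact (ENNReal.ofReal_toReal (hfin q)).symm
  have hmain := (pow_le_pow_left₀ zero_le hlow 2).trans (hcs.trans (mul_le_mul_right hup _))
  rw [← ENNReal.ofReal_pow (by positivity), ← ENNReal.ofReal_pow hF0,
    ← ENNReal.ofReal_mul (by positivity), ENNReal.ofReal_le_ofReal_iff (by positivity)] at hmain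
  have h1 : N * (t * ((1 / n) ^ n * δ ^ (l + 1))) ^ 2 ≤ F ^ 2 * B := by
    refine le_of_mul_le_mul_left ?_ hcard
    linarith
  rw [weakConst]
  have e1 : N * t ^ 2 * δ ^ n = N * (t * ((1 / n) ^ n * δ ^ (l + 1))) ^ 2 *
      (δ ^ n / ((1 / n) ^ n * δ ^ (l + 1)) ^ 2) := by
    field_simp
  rw [e1]
  refine (mul_le_mul_of_nonneg_right h1 (by positivity)).trans (le_of_eq ?_)
  rw [hB]; field_simp

theorem volume_nikodym_gt_le {d n l : ℕ} (hn : d + (l + 1) = n) {δ : ℝ} (hδ : 0 < δ)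
    (hδ1 : δ ≤ 1 / 2) {K : ℕ} (hK : 3 < 2 ^ K * δ) {f : EuclideanSpace ℝ (Fin n) → ℂ}
    (hf : MemLp f 2 volume) {t : ℝ≥0} (ht : 0 < t) :
    volume {x | (t : ℝ≥0∞) < nikodym d n δ f x} ≤
      ENNReal.ofReal (unitBallVolume n * weakConst d n l *
        (∑ k ∈ Finset.range (K + 1), ((2 : ℝ) ^ l) ^ k) *
          (eLpNorm f 2 volume).toReal ^ 2 / t ^ 2) := by
  classical
  set E := {x | (t : ℝ≥0∞) < nikodym d n δ f x} with hE
  have ht' : (0 : ℝ) < t := ht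
  have hβ := unitBallVolume_pos n
  rcases E.eq_empty_or_nonempty with h0 | ⟨x₀, hx₀⟩
  · simp [h0]
  -- Off `E` the choice is arbitrary; a point of `E` is needed only to know that `Gr d n` is
  -- inhabited.
  have hex : ∀ p, ∃ σ : Gr d n, p ∈ E →
      (t : ℝ≥0∞) < ⨍⁻ y in p +ᵥ plate δ σ, ‖f y‖ₑ ∂volume := by
    intro p
    by_cases hp : p ∈ E
    · obtain ⟨σ, hσ⟩ := lt_iSup_iff.1 (show (t : ℝ≥0∞) < nikodym d n δ f p from hp)
      exact ⟨σ, fun _ => hσ⟩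
    · obtain ⟨σ, -⟩ := lt_iSup_iff.1 (show (t : ℝ≥0∞) < nikodym d n δ f x₀ from hx₀)
      exact ⟨σ, fun h => (hp h).elim⟩
  choose σ hσ using hex
  set X := weakConst d n l * (∑ k ∈ Finset.range (K + 1), ((2 : ℝ) ^ l) ^ k) *
        (eLpNorm f 2 volume).toReal ^ 2 with hX
  let P : Finset (EuclideanSpace ℝ (Fin n)) → Prop := fun S =>
    (∀ p ∈ S, p ∈ E) ∧ ∀ p ∈ S, ∀ q ∈ S, p ≠ q → δ ≤ dist p q
  have hbound : ∀ S, P S → (S.card : ℝ) * t ^ 2 * δ ^ n ≤ X := fun S hS =>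
    card_mul_sq_le hn hδ hδ1 hK S hS.2 σ hf t fun p hp => hσ p (hS.1 p hp)
  -- The discrete estimate bounds the cardinality of all separated subsets of `E`, so a largest one
  -- exists; by maximality its `δ`-balls cover `E`.
  let cards : Set ℕ := {k | ∃ S, P S ∧ S.card = k}
  have hbdd : BddAbove cards := by
    refine ⟨⌊X / (t ^ 2 * δ ^ n)⌋₊, ?_⟩
    rintro k ⟨S, hS, rfl⟩
    refine Nat.le_floor ?_
    rw [le_div_iff₀ (by positivity), ← mul_assoc]
    exact hbound S hS
  obtain ⟨S, hS, hcard⟩ := Nat.sSup_mem (s := cards) ⟨0, ∅, by simp [P], rfl⟩ hbdd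
  have hcover : E ⊆ ⋃ p ∈ S, Metric.ball p δ := by
    intro x hx
    by_contra hcon
    simp only [Set.mem_iUnion, Metric.mem_ball, not_exists, not_lt] at hcon
    have hxS : x ∉ S := fun h => by
      have := hcon x h
      rw [dist_self] at this; linarith
    have hP : P (insert x S) := by
      refine ⟨?_, ?_⟩
      · intro p hp
        rcases Finset.mem_insert.1 hp with rfl | hp
        exacts [hx, hS.1 p hp]
      · intro p hp q hq hpq
        rcases Finset.mem_insert.1 hp with h₁ | h₁ <;> rcases Finset.mem_insert.1 hq with h₂ | h₂
        · exact (hpq (h₁.trans h₂.symm)).elim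
        · rw [h₁]; exact hcon q h₂
        · rw [h₂, dist_comm]; exact hcon p h₁
        · exact hS.2 p h₁ q h₂ hpq
    have := le_csSup hbdd ⟨_, hP, rfl⟩
    rw [Finset.card_insert_of_notMem hxS] at this
    omega
  refine (measure_mono hcover).trans ((measure_biUnion_finset_le _ _).trans ?_)
  simp only [volume_ball_eq _ hδ, Finset.sum_const, nsmul_eq_mul]
  rw [← ENNReal.ofReal_natCast, ← ENNReal.ofReal_mul (by positivity)]
  refine ENNReal.ofReal_le_ofReal ?_
  rw [le_div_iff₀ (by positivity)]
  have := mul_le_mul_of_nonneg_left (hbound S hS) hβ.le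
  rw [hX] at this
  linarith

/-- A rearrangement of a distributional bound into the weak-`L²` form. -/
theorem mul_rpow_half_le {v : ℝ≥0∞} {X F : ℝ} (hX : 0 ≤ X) (hF : 0 ≤ F) {t : ℝ≥0} (ht : 0 < t)
    (hv : v ≤ ENNReal.ofReal (X * F ^ 2 / t ^ 2)) :
    (t : ℝ≥0∞) * v ^ (1 / 2 : ℝ) ≤ ENNReal.ofReal (√X) * ENNReal.ofReal F := by
  have ht' : (0 : ℝ) < t := ht
  have h1 : X * F ^ 2 / t ^ 2 = (√X * F / t) ^ 2 := by
    rw [div_pow, mul_pow, Real.sq_sqrt hX]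
  calc (t : ℝ≥0∞) * v ^ (1 / 2 : ℝ)
      ≤ t * ENNReal.ofReal ((√X * F / t) ^ 2) ^ (1 / 2 : ℝ) := by
        rw [← h1]; gcongr
    _ = ENNReal.ofReal (t * (√X * F / t)) := by
        rw [ENNReal.ofReal_rpow_of_nonneg (by positivity) (by positivity), ← Real.sqrt_eq_rpow,
          Real.sqrt_sq (by positivity), ENNReal.ofReal_mul (by positivity),
          ENNReal.ofReal_coe_nnreal]
    _ = _ := by
        rw [mul_div_cancel₀ _ ht'.ne', ENNReal.ofReal_mul (by positivity)]

theorem nikodymWeakNorm_le {d n l : ℕ} (hn : d + (l + 1) = n) {δ : ℝ} (hδ : 0 < δ)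
    (hδ1 : δ ≤ 1 / 2) {K : ℕ} (hK : 3 < 2 ^ K * δ) :
    nikodymWeakNorm d n δ ≤ ENNReal.ofReal (√(unitBallVolume n * weakConst d n l *
        (∑ k ∈ Finset.range (K + 1), ((2 : ℝ) ^ l) ^ k))) := by
  refine sInf_le fun f hf => iSup_le fun t => ?_
  rcases eq_or_lt_of_le (zero_le (a := t)) with rfl | ht
  · simp
  have hβ := unitBallVolume_pos n
  have hC := weakConst_pos (d := d) (l := l) (show 0 < n by omega)
  have := mul_rpow_half_le (by positivity) ENNReal.toReal_nonneg ht
    (volume_nikodym_gt_le hn hδ hδ1 hK hf ht)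
  rwa [ENNReal.ofReal_toReal hf.2.ne] at this

/-! ### The strong bound, by localization and summation over levels. -/

theorem vadd_plate_subset_ball {d n : ℕ} {δ : ℝ} (hδ1 : δ ≤ 1) (σ : Gr d n)
    {x z : EuclideanSpace ℝ (Fin n)} (hx : x ∈ Metric.ball z 1) :
    x +ᵥ plate δ σ ⊆ Metric.ball z 3 := by
  intro y hy
  rw [mem_vadd_plate] at hy
  have h1 := norm_le_starProjection_add σ.1 (y - x)
  rw [Metric.mem_ball] at hx ⊢
  have h2 := dist_triangle y x z
  rw [dist_eq_norm y x] at h2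
  linarith [hy.1, hy.2]

theorem nikodym_indicator_ball {d n : ℕ} {δ : ℝ} (hδ1 : δ ≤ 1)
    (f : EuclideanSpace ℝ (Fin n) → ℂ) {x z : EuclideanSpace ℝ (Fin n)}
    (hx : x ∈ Metric.ball z 1) :
    nikodym d n δ ((Metric.ball z 3).indicator f) x = nikodym d n δ f x := by
  refine iSup_congr fun σ => ?_
  rw [setLAverage_eq, setLAverage_eq]
  congr 1
  refine setLIntegral_congr_fun (measurableSet_vadd_plate δ σ x) fun y hy => ?_
  simp only [Set.indicator_of_mem (vadd_plate_subset_ball hδ1 σ hx hy)]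

/-- Cauchy-Schwarz on a single plate, whose volume is at least `4 ^ (-Q)`. This caps the number of
dyadic levels at `Q`. -/
theorem nikodym_le_mul_eLpNorm {d n m : ℕ} (hn : d + m = n) (hn0 : 0 < n) {δ : ℝ} (hδ : 0 < δ)
    {Q : ℕ} (hQ : 1 ≤ 4 ^ Q * ((1 / n) ^ n * δ ^ m)) {f : EuclideanSpace ℝ (Fin n) → ℂ}
    (hf : AEStronglyMeasurable f volume) (x : EuclideanSpace ℝ (Fin n)) :
    nikodym d n δ f x ≤ 2 ^ Q * eLpNorm f 2 volume := by
  refine iSup_le fun σ => ?_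
  rw [setLAverage_eq]
  refine ENNReal.div_le_of_le_mul ?_
  have h1 := sq_sum_setLIntegral_le (μ := volume) {()}
    (fun _ => measurableSet_vadd_plate δ σ x) hf.enorm
  simp only [Finset.sum_singleton, Set.inter_self, lintegral_enorm_sq_eq] at h1
  set V := volume (x +ᵥ plate δ σ)
  have hV : 1 ≤ 4 ^ Q * V := by
    calc (1 : ℝ≥0∞) = ENNReal.ofReal 1 := by simp
      _ ≤ ENNReal.ofReal (4 ^ Q * ((1 / n) ^ n * δ ^ m)) := ENNReal.ofReal_le_ofReal hQ
      _ = 4 ^ Q * ENNReal.ofReal ((1 / n) ^ n * δ ^ m) := by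
        rw [ENNReal.ofReal_mul (by positivity), ENNReal.ofReal_pow (by norm_num)]; simp
      _ ≤ 4 ^ Q * V := by gcongr; exact le_volume_vadd_plate hn hn0 hδ σ x
  refine (ENNReal.pow_le_pow_left_iff two_ne_zero).1 (h1.trans ?_)
  calc eLpNorm f 2 volume ^ 2 * V ≤ eLpNorm f 2 volume ^ 2 * V * (4 ^ Q * V) :=
        le_mul_of_one_le_right zero_le hV
    _ = (2 ^ Q * eLpNorm f 2 volume * V) ^ 2 := by
        rw [mul_pow, mul_pow, ← pow_mul, mul_comm Q 2, pow_mul]; norm_num; ring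

theorem le_add_sum_dyadic {a u : ℝ≥0∞} (Q : ℕ) (h : u ≤ 4 ^ Q * a) :
    u ≤ a + ∑ k ∈ Finset.range Q, if 4 ^ k * a < u then 4 ^ (k + 1) * a else 0 := by
  induction Q with
  | zero => simpa using h
  | succ Q ih =>
    rw [Finset.sum_range_succ]
    by_cases hu : u ≤ 4 ^ Q * a
    · exact (ih hu).trans (by gcongr; exact le_self_add)
    · rw [if_pos (not_le.1 hu)]
      exact h.trans (le_add_self.trans le_add_self)

theorem lintegral_setLIntegral_ball {n : ℕ} {h : EuclideanSpace ℝ (Fin n) → ℝ≥0∞}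
    (hh : Measurable h) {r : ℝ} (hr : 0 < r) :
    ∫⁻ z, ∫⁻ x in Metric.ball z r, h x =
      ENNReal.ofReal (r ^ n * unitBallVolume n) * ∫⁻ x, h x := by
  have hset : MeasurableSet {p : EuclideanSpace ℝ (Fin n) × EuclideanSpace ℝ (Fin n) |
      dist p.2 p.1 < r} := measurableSet_lt (by fun_prop) (by fun_prop)
  calc ∫⁻ z, ∫⁻ x in Metric.ball z r, h x
      = ∫⁻ z, ∫⁻ x, {p : EuclideanSpace ℝ (Fin n) × EuclideanSpace ℝ (Fin n) |
          dist p.2 p.1 < r}.indicator (fun p => h p.2) (z, x) := by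
        refine lintegral_congr fun z => ?_
        rw [← lintegral_indicator measurableSet_ball]; rfl
    _ = ∫⁻ x, ∫⁻ z, {p : EuclideanSpace ℝ (Fin n) × EuclideanSpace ℝ (Fin n) |
          dist p.2 p.1 < r}.indicator (fun p => h p.2) (z, x) :=
        lintegral_lintegral_swap ((hh.comp measurable_snd).indicator hset).aemeasurable
    _ = ∫⁻ x, ENNReal.ofReal (r ^ n * unitBallVolume n) * h x := by
        refine lintegral_congr fun x => ?_
        rw [← volume_ball_eq x hr, mul_comm, ← setLIntegral_const,
          ← lintegral_indicator measurableSet_ball]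
        refine lintegral_congr fun z => ?_
        simp only [Set.indicator, Set.mem_ofPred_eq, Metric.mem_ball, dist_comm]
    _ = _ := lintegral_const_mul _ hh

/-- Values of `ψ` below `G ^ 2` are paid for by the volume of the ball, which is why the problem is
localized. Each of the `Q` levels above contributes at most `4 * X * G ^ 2`, since the weak bound
decays exactly as the height grows. -/
theorem setLIntegral_ball_le {d n m : ℕ} (hn : d + m = n) (hn0 : 0 < n) {δ : ℝ} (hδ : 0 < δ)
    (hδ1 : δ ≤ 1) {X : ℝ} (hX : 0 ≤ X)
    (hweak : ∀ g : EuclideanSpace ℝ (Fin n) → ℂ, MemLp g 2 volume → ∀ t : ℝ≥0, 0 < t →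
      volume {x | (t : ℝ≥0∞) < nikodym d n δ g x} ≤
        ENNReal.ofReal (X * (eLpNorm g 2 volume).toReal ^ 2 / t ^ 2))
    {Q : ℕ} (hQ : 1 ≤ 4 ^ Q * ((1 / n) ^ n * δ ^ m)) {f : EuclideanSpace ℝ (Fin n) → ℂ}
    (hf : MemLp f 2 volume) {ψ : EuclideanSpace ℝ (Fin n) → ℝ≥0∞} (hψ : Measurable ψ)
    (hψf : ∀ x, ψ x ≤ nikodym d n δ f x ^ 2) (z : EuclideanSpace ℝ (Fin n)) :
    ∫⁻ x in Metric.ball z 1, ψ x ≤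
      ENNReal.ofReal (unitBallVolume n + 4 * Q * X) * ∫⁻ y in Metric.ball z 3, ‖f y‖ₑ ^ 2 := by
  have hβ := unitBallVolume_pos n
  set g := (Metric.ball z 3).indicator f with hg
  have hgL : MemLp g 2 volume := hf.indicator measurableSet_ball
  have hint : ∫⁻ y in Metric.ball z 3, ‖f y‖ₑ ^ 2 = eLpNorm g 2 volume ^ 2 := by
    rw [← lintegral_enorm_sq_eq, ← lintegral_indicator measurableSet_ball]
    refine lintegral_congr fun y => ?_
    by_cases hy : y ∈ Metric.ball z 3 <;> simp [hg, Set.indicator, hy]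
  obtain ⟨G, hG0, hGe⟩ : ∃ G : ℝ≥0, (eLpNorm g 2 volume).toReal = G ∧ eLpNorm g 2 volume = G :=
    ⟨(eLpNorm g 2 volume).toNNReal, rfl, (ENNReal.coe_toNNReal hgL.2.ne).symm⟩
  rw [hint, hGe]
  have hψg : ∀ x ∈ Metric.ball z 1, ψ x ≤ nikodym d n δ g x ^ 2 := fun x hx => by
    rw [nikodym_indicator_ball hδ1 f hx]; exact hψf x
  have hbound : ∀ x ∈ Metric.ball z 1, ψ x ≤ 4 ^ Q * (G : ℝ≥0∞) ^ 2 := fun x hx => by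
    refine (hψg x hx).trans ?_
    refine (pow_le_pow_left₀ zero_le (nikodym_le_mul_eLpNorm hn hn0 hδ hQ hgL.1 x) 2).trans ?_
    rw [hGe, mul_pow, ← pow_mul, mul_comm Q 2, pow_mul]; norm_num
  have hmeas : ∀ k : ℕ, MeasurableSet {x | 4 ^ k * (G : ℝ≥0∞) ^ 2 < ψ x} := fun k =>
    measurableSet_lt measurable_const hψ
  have hlevel : ∀ k : ℕ, 4 ^ (k + 1) * (G : ℝ≥0∞) ^ 2 *
      volume ({x | 4 ^ k * (G : ℝ≥0∞) ^ 2 < ψ x} ∩ Metric.ball z 1) ≤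
        ENNReal.ofReal (4 * X) * (G : ℝ≥0∞) ^ 2 := by
    intro k
    rcases eq_or_lt_of_le (zero_le (a := G)) with h0 | hG
    · simp [← h0]
    have hsub : {x | 4 ^ k * (G : ℝ≥0∞) ^ 2 < ψ x} ∩ Metric.ball z 1 ⊆
        {x | ((2 ^ k * G : ℝ≥0) : ℝ≥0∞) < nikodym d n δ g x} := by
      rintro x ⟨h1, h2⟩
      have h3 := lt_of_lt_of_le h1 (hψg x h2)
      have h4 : 4 ^ k * (G : ℝ≥0∞) ^ 2 = ((2 ^ k * G : ℝ≥0) : ℝ≥0∞) ^ 2 := by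
        push_cast
        rw [mul_pow, ← pow_mul, mul_comm k 2, pow_mul]; norm_num
      rw [h4] at h3
      exact lt_of_not_ge fun h => absurd h3 (not_lt.2 (pow_le_pow_left₀ zero_le h 2))
    have hv := (measure_mono hsub).trans (hweak g hgL (2 ^ k * G) (by positivity))
    have hG' : (0 : ℝ) < G := hG
    have e1 : X * (eLpNorm g 2 volume).toReal ^ 2 / ((2 ^ k * G : ℝ≥0) : ℝ) ^ 2 = X / 4 ^ k := by
      rw [hG0]; push_cast
      rw [mul_pow, ← pow_mul, mul_comm k 2, pow_mul]; field_simp; norm_num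
    rw [e1] at hv
    calc _ ≤ 4 ^ (k + 1) * (G : ℝ≥0∞) ^ 2 * ENNReal.ofReal (X / 4 ^ k) := by gcongr
      _ = 4 ^ (k + 1) * ENNReal.ofReal (X / 4 ^ k) * (G : ℝ≥0∞) ^ 2 := by ring
      _ = _ := by
        congr 1
        have : (4 : ℝ≥0∞) ^ (k + 1) = ENNReal.ofReal (4 ^ (k + 1)) := by
          rw [ENNReal.ofReal_pow (by norm_num)]; simp
        rw [this, ← ENNReal.ofReal_mul (by positivity)]
        congr 1
        rw [pow_succ]; field_simp
  calc ∫⁻ x in Metric.ball z 1, ψ x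
      ≤ ∫⁻ x in Metric.ball z 1, ((G : ℝ≥0∞) ^ 2 + ∑ k ∈ Finset.range Q,
          {x | 4 ^ k * (G : ℝ≥0∞) ^ 2 < ψ x}.indicator (fun _ => 4 ^ (k + 1) * (G : ℝ≥0∞) ^ 2) x) := by
        refine setLIntegral_mono' measurableSet_ball fun x hx => ?_
        simpa only [Set.indicator, Set.mem_ofPred_eq] using le_add_sum_dyadic Q (hbound x hx)
    _ = (G : ℝ≥0∞) ^ 2 * volume (Metric.ball z 1) + ∑ k ∈ Finset.range Q,
          4 ^ (k + 1) * (G : ℝ≥0∞) ^ 2 *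
            volume ({x | 4 ^ k * (G : ℝ≥0∞) ^ 2 < ψ x} ∩ Metric.ball z 1) := by
        rw [lintegral_add_left measurable_const, setLIntegral_const,
          lintegral_finsetSum _ fun k _ => measurable_const.indicator (hmeas k)]
        congr 1
        refine Finset.sum_congr rfl fun k _ => ?_
        rw [lintegral_indicator_const (hmeas k), Measure.restrict_apply (hmeas k)]
    _ ≤ (G : ℝ≥0∞) ^ 2 * ENNReal.ofReal (unitBallVolume n) +
          Q • (ENNReal.ofReal (4 * X) * (G : ℝ≥0∞) ^ 2) := by
        gcongr
        · rw [volume_ball_eq z one_pos, one_pow, one_mul]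
        · exact (Finset.sum_le_card_nsmul _ _ _ fun k _ => hlevel k).trans (by simp)
    _ = _ := by
        rw [ENNReal.ofReal_add hβ.le (by positivity), nsmul_eq_mul,
          show 4 * (Q : ℝ) * X = Q * (4 * X) by ring, ENNReal.ofReal_mul (p := (Q : ℝ)) (by positivity),
          ENNReal.ofReal_natCast]
        ring

theorem lintegral_nikodym_sq_le {d n m : ℕ} (hn : d + m = n) (hn0 : 0 < n) {δ : ℝ} (hδ : 0 < δ)
    (hδ1 : δ ≤ 1) {X : ℝ} (hX : 0 ≤ X)
    (hweak : ∀ g : EuclideanSpace ℝ (Fin n) → ℂ, MemLp g 2 volume → ∀ t : ℝ≥0, 0 < t →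
      volume {x | (t : ℝ≥0∞) < nikodym d n δ g x} ≤
        ENNReal.ofReal (X * (eLpNorm g 2 volume).toReal ^ 2 / t ^ 2))
    {Q : ℕ} (hQ : 1 ≤ 4 ^ Q * ((1 / n) ^ n * δ ^ m)) {f : EuclideanSpace ℝ (Fin n) → ℂ}
    (hf : MemLp f 2 volume) :
    ∫⁻ x, nikodym d n δ f x ^ 2 ≤
      ENNReal.ofReal (3 ^ n * (unitBallVolume n + 4 * Q * X)) * eLpNorm f 2 volume ^ 2 := by
  have hβ := unitBallVolume_pos n
  -- A measurable minorant with the same integral replaces the maximal function, so its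
  -- measurability is never needed; likewise `f'` is a measurable representative of `f`. Tonelli is
  -- then available for averaging over `z`.
  obtain ⟨ψ, hψ, hψf, hψint⟩ := exists_measurable_le_lintegral_eq volume
    fun x => nikodym d n δ f x ^ 2
  obtain ⟨f', hf', hff'⟩ := hf.1
  have hsq : Measurable fun y => ‖f' y‖ₑ ^ 2 := hf'.measurable.enorm.pow_const 2
  have hlocal : ∀ z, ∫⁻ x in Metric.ball z 1, ψ x ≤
      ENNReal.ofReal (unitBallVolume n + 4 * Q * X) *
        ∫⁻ y in Metric.ball z 3, ‖f' y‖ₑ ^ 2 := by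
    intro z
    refine (setLIntegral_ball_le hn hn0 hδ hδ1 hX hweak hQ hf hψ hψf z).trans (le_of_eq ?_)
    congr 1
    exact lintegral_congr_ae ((ae_restrict_of_ae hff').mono fun y hy => by simp [hy])
  have h1 := lintegral_setLIntegral_ball hψ one_pos
  have h3 := lintegral_setLIntegral_ball hsq three_pos
  have hm : ENNReal.ofReal (1 ^ n * unitBallVolume n) * ∫⁻ x, ψ x ≤
      ENNReal.ofReal (1 ^ n * unitBallVolume n) *
        (ENNReal.ofReal (3 ^ n * (unitBallVolume n + 4 * Q * X)) * ∫⁻ y, ‖f' y‖ₑ ^ 2) := by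
    rw [← h1]
    refine (lintegral_mono hlocal).trans ?_
    rw [lintegral_const_mul' _ _ ENNReal.ofReal_ne_top, h3, ← mul_assoc, ← mul_assoc,
      ← ENNReal.ofReal_mul (by positivity), ← ENNReal.ofReal_mul (by positivity)]
    refine le_of_eq ?_
    congr 2; ring
  rw [hψint, ← lintegral_enorm_sq_eq,
    show ∫⁻ y, ‖f y‖ₑ ^ 2 = ∫⁻ y, ‖f' y‖ₑ ^ 2 from
      lintegral_congr_ae (hff'.mono fun y hy => by simp [hy])]
  refine (ENNReal.mul_le_mul_iff_right ?_ ENNReal.ofReal_ne_top).1 hm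
  simpa using hβ

theorem nikodymStrongNorm_le {d n l : ℕ} (hn : d + (l + 1) = n) {δ : ℝ} (hδ : 0 < δ)
    (hδ1 : δ ≤ 1 / 2) {K : ℕ} (hK : 3 < 2 ^ K * δ) {Q : ℕ}
    (hQ : 1 ≤ 4 ^ Q * ((1 / n) ^ n * δ ^ (l + 1))) :
    nikodymStrongNorm d n δ ≤ ENNReal.ofReal (√(3 ^ n * (unitBallVolume n + 4 * Q *
      (unitBallVolume n * weakConst d n l *
        (∑ k ∈ Finset.range (K + 1), ((2 : ℝ) ^ l) ^ k))))) := by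
  have hβ := unitBallVolume_pos n
  have hC := weakConst_pos (d := d) (l := l) (show 0 < n by omega)
  refine sInf_le fun f hf => ?_
  have h := lintegral_nikodym_sq_le hn (by omega) hδ (by linarith)
    (X := unitBallVolume n * weakConst d n l *
        (∑ k ∈ Finset.range (K + 1), ((2 : ℝ) ^ l) ^ k)) (by positivity)
    (fun g hg t ht => volume_nikodym_gt_le hn hδ hδ1 hK hg ht) hQ hf
  have e : ∫⁻ x, nikodym d n δ f x ^ 2 = eLpNorm (nikodym d n δ f) 2 volume ^ 2 := by
    rw [← lintegral_enorm_sq_eq]; simp only [enorm_eq_self]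
  rw [e] at h
  refine (ENNReal.pow_le_pow_left_iff two_ne_zero).1 (h.trans (le_of_eq ?_))
  rw [mul_pow, ← ENNReal.ofReal_pow (by positivity), Real.sq_sqrt (by positivity)]

/-! ### The lower bounds: adapted bases and the extremal function. -/

section spans

variable {F : Type*} [NormedAddCommGroup F] [InnerProductSpace ℝ F] {ι κ : Type*} [Fintype ι]

theorem mem_span_basis_of_mem_range (b : OrthonormalBasis ι ℝ F) {g : κ → ι} {i : ι}
    (hi : i ∈ Set.range g) : b i ∈ Submodule.span ℝ (Set.range (b ∘ g)) := by
  obtain ⟨k, rfl⟩ := hi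
  exact Submodule.subset_span ⟨k, rfl⟩

theorem mem_orthogonal_span_basis (b : OrthonormalBasis ι ℝ F) {g : κ → ι} {i : ι}
    (hi : i ∉ Set.range g) : b i ∈ (Submodule.span ℝ (Set.range (b ∘ g)))ᗮ := by
  rw [Submodule.mem_orthogonal]
  intro u hu
  induction hu using Submodule.span_induction with
  | mem u hu =>
    obtain ⟨k, rfl⟩ := hu
    exact b.orthonormal.inner_eq_zero fun h => hi ⟨k, h⟩
  | zero => simp
  | add u v _ _ hu hv => rw [inner_add_left, hu, hv, add_zero]
  | smul c u _ hu => rw [inner_smul_left, hu, mul_zero]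

theorem mem_span_or_mem_orthogonal (b : OrthonormalBasis ι ℝ F) (g : κ → ι) (i : ι) :
    b i ∈ Submodule.span ℝ (Set.range (b ∘ g)) ∨
      b i ∈ (Submodule.span ℝ (Set.range (b ∘ g)))ᗮ := by
  by_cases hi : i ∈ Set.range g
  · exact .inl (mem_span_basis_of_mem_range b hi)
  · exact .inr (mem_orthogonal_span_basis b hi)

theorem mem_range_of_mem_span_basis (b : OrthonormalBasis ι ℝ F) {g : κ → ι} {i : ι}
    (hi : b i ∈ Submodule.span ℝ (Set.range (b ∘ g))) : i ∈ Set.range g := by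
  by_contra h
  have := Submodule.inner_right_of_mem_orthogonal hi (mem_orthogonal_span_basis b h)
  simp at this

theorem notMem_range_of_mem_orthogonal (b : OrthonormalBasis ι ℝ F) {g : κ → ι} {i : ι}
    (hi : b i ∈ (Submodule.span ℝ (Set.range (b ∘ g)))ᗮ) : i ∉ Set.range g := by
  intro h
  have := Submodule.inner_right_of_mem_orthogonal (mem_span_basis_of_mem_range b h) hi
  simp at this

theorem finrank_span_basis [Fintype κ] (b : OrthonormalBasis ι ℝ F) {g : κ → ι}
    (hg : Function.Injective g) :
    Module.finrank ℝ (Submodule.span ℝ (Set.range (b ∘ g))) = Fintype.card κ :=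
  finrank_span_eq_card (b.orthonormal.linearIndependent.comp g hg)

/-- An orthonormal basis can be modified, keeping its first block, so that the span of the first
block and of the next vector contains a given point. -/
theorem exists_orthonormalBasis_mem_span [FiniteDimensional ℝ F] {k m : ℕ}
    (b₀ : OrthonormalBasis (Fin k ⊕ (Unit ⊕ Fin m)) ℝ F) (x : F) :
    ∃ b : OrthonormalBasis (Fin k ⊕ (Unit ⊕ Fin m)) ℝ F, b ∘ Sum.inl = b₀ ∘ Sum.inl ∧
      x ∈ Submodule.span ℝ (Set.range (b ∘ (Sum.map id Sum.inl : Fin k ⊕ Unit → _))) := by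
  classical
  set V := Submodule.span ℝ (Set.range (b₀ ∘ (Sum.inl : Fin k → Fin k ⊕ (Unit ⊕ Fin m)))) with hV
  -- The new vector `e` is the normalized component of `x` orthogonal to `V`; if `x` lies in `V`,
  -- the old basis vector serves.
  obtain ⟨e, he1, heV, c, hc⟩ : ∃ e : F, ‖e‖ = 1 ∧ e ∈ Vᗮ ∧ ∃ c : ℝ, Vᗮ.starProjection x = c • e := by
    by_cases hw : Vᗮ.starProjection x = 0
    · exact ⟨b₀ (.inr (.inl ())), b₀.norm_eq_one _, mem_orthogonal_span_basis b₀ (by simp), 0,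
        by simp [hw]⟩
    · refine ⟨(‖Vᗮ.starProjection x‖⁻¹ : ℝ) • Vᗮ.starProjection x, norm_smul_inv_norm hw,
        Vᗮ.smul_mem _ (Submodule.starProjection_apply_mem _ _), ‖Vᗮ.starProjection x‖, ?_⟩
      rw [smul_smul, mul_inv_cancel₀ (norm_ne_zero_iff.2 hw), one_smul]
  let v : Fin k ⊕ (Unit ⊕ Fin m) → F := Sum.elim (fun i => b₀ (.inl i)) (fun _ => e)
  let s : Set (Fin k ⊕ (Unit ⊕ Fin m)) := Set.range (Sum.map id Sum.inl : Fin k ⊕ Unit → _)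
  have hbe : ∀ i, inner ℝ (b₀ (.inl i)) e = 0 := fun i =>
    Submodule.inner_right_of_mem_orthogonal (mem_span_basis_of_mem_range b₀ ⟨i, rfl⟩) heV
  have hs : Orthonormal ℝ (s.domRestrict v) := by
    rw [orthonormal_iff_ite]
    rintro ⟨_, i | i, rfl⟩ ⟨_, j | j, rfl⟩
    · simpa [v] using orthonormal_iff_ite.1 b₀.orthonormal (.inl i) (.inl j)
    · simpa [v] using hbe i
    · simpa [v, real_inner_comm] using hbe j
    · simp [v, he1]
  obtain ⟨b, hb⟩ := Orthonormal.exists_orthonormalBasis_extension_of_card_eq (𝕜 := ℝ)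
    (Module.finrank_eq_card_basis b₀.toBasis) hs
  have hinl : b ∘ Sum.inl = b₀ ∘ Sum.inl := by
    funext i
    exact hb (.inl i) ⟨.inl i, rfl⟩
  have hmid : b (.inr (.inl ())) = e := hb _ ⟨.inr (), rfl⟩
  refine ⟨b, hinl, ?_⟩
  rw [← Submodule.starProjection_add_starProjection_orthogonal (K := V) x, hc, ← hmid]
  refine Submodule.add_mem _ ?_ (Submodule.smul_mem _ _ (mem_span_basis_of_mem_range b ⟨.inr (), rfl⟩))
  have hle : V ≤ Submodule.span ℝ (Set.range (b ∘ (Sum.map id Sum.inl : Fin k ⊕ Unit → _))) := by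
    rw [hV, ← hinl]
    refine Submodule.span_mono ?_
    rintro _ ⟨i, rfl⟩
    exact ⟨.inl i, rfl⟩
  exact hle (Submodule.starProjection_apply_mem _ _)

end spans

/-- If `τ` is spanned by the first block and the next vector of `b`, and contains `x`, then the
plate at `x` along `τ` meets the `ρ`-neighbourhood of the first block in a large box. -/
theorem le_volume_inter_slab {d n l : ℕ} (hn : d + (1 + (l + 1)) = n) {δ ρ : ℝ} (hδ : 0 < δ)
    (hδρ : δ ≤ ρ) (hρ : ρ ≤ 1)
    (b : OrthonormalBasis (Fin d ⊕ (Unit ⊕ Fin (l + 1))) ℝ (EuclideanSpace ℝ (Fin n)))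
    {τ : Gr (d + 1) n}
    (hτ : τ.1 = Submodule.span ℝ (Set.range (b ∘ (Sum.map id Sum.inl : Fin d ⊕ Unit → _))))
    {x : EuclideanSpace ℝ (Fin n)} (hxτ : x ∈ τ.1) (hx : ‖x‖ ≤ 1 / 4) :
    ENNReal.ofReal ((1 / (2 * n)) ^ n * (ρ * δ ^ (l + 1))) ≤
      volume ((x +ᵥ plate δ τ) ∩ slab (Submodule.span ℝ (Set.range (b ∘ Sum.inl))) 1 ρ) := by
  have hn0 : (0 : ℝ) < n := by exact_mod_cast (show 0 < n by omega)
  have hρ0 : 0 < ρ := hδ.trans_le hδρ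
  -- Since `x` lies in `τ` and is short, its plate surrounds the origin, so a box centred there
  -- works: unit scale along the first block, `ρ` along the next vector, `δ` along the rest.
  have hbox := volume_box b
    (a := Sum.elim (fun _ => 1 / (4 * n)) (Sum.elim (fun _ => ρ / (4 * n)) (fun _ => δ / (4 * n))))
    (by rintro (i | i | i) <;> simp <;> positivity)
  have hp : ∏ i, 2 * (Sum.elim (fun _ => 1 / (4 * n))
      (Sum.elim (fun _ => ρ / (4 * n)) (fun _ => δ / (4 * n))) :
        Fin d ⊕ (Unit ⊕ Fin (l + 1)) → ℝ) i = (1 / (2 * n)) ^ n * (ρ * δ ^ (l + 1)) := by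
    have e1 : 2 * (1 / (4 * (n : ℝ))) = 1 / (2 * n) := by field_simp; norm_num
    have e2 : ∀ r : ℝ, 2 * (r / (4 * (n : ℝ))) = 1 / (2 * n) * r := fun r => by
      field_simp; ring
    simp only [Fintype.prod_sum_type, Sum.elim_inl, Sum.elim_inr, e1, e2, Finset.prod_const,
      Finset.card_univ, Fintype.card_fin, Fintype.card_unit, mul_pow, pow_one]
    obtain ⟨q, hq⟩ : ∃ q : ℝ, q = 1 / (2 * n) := ⟨_, rfl⟩
    rw [← hq, ← hn]; ring
  rw [← hp, ← hbox]
  have hcard : (Fintype.card (Fin d ⊕ (Unit ⊕ Fin (l + 1))) : ℝ) = n := by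
    rw [← hn]; simp
  have hquarter : ∀ r : ℝ, (n : ℝ) * (r / (4 * n)) = r / 4 := fun r => by field_simp
  have hle : ∀ r s : ℝ, r ≤ s → r / (4 * n) ≤ s / (4 * n) := fun r s h => by gcongr
  refine measure_mono fun y hy => ⟨?_, ?_, ?_⟩
  · rw [mem_vadd_plate]
    constructor
    · rw [map_sub]
      refine (norm_sub_le _ _).trans ?_
      have h1 : ‖τ.1.starProjection y‖ ≤ n * (1 / (4 * n)) := by
        rw [← hcard, hτ]
        refine norm_starProjection_le_of_basis b _ (mem_span_or_mem_orthogonal b _)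
          (by positivity) fun i hi => ?_
        rw [hcard]
        obtain ⟨j | j, rfl⟩ := mem_range_of_mem_span_basis b hi
        · exact hy (.inl j)
        · exact (hy (.inr (.inl j))).trans (hle _ _ hρ)
      have h2 := Submodule.norm_starProjection_apply_le τ.1 x
      rw [hquarter] at h1
      linarith
    · rw [map_sub, (Submodule.starProjection_apply_eq_zero_iff _).2
        (Submodule.le_orthogonal_orthogonal _ hxτ), sub_zero]
      have h1 : ‖(τ.1)ᗮ.starProjection y‖ ≤ n * (δ / (4 * n)) := by
        rw [← hcard, hτ]
        refine norm_starProjection_le_of_basis b _ (fun i => ?_) (by positivity) fun i hi => ?_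
        · rw [Submodule.orthogonal_orthogonal]; exact (mem_span_or_mem_orthogonal b _ i).symm
        rw [hcard]
        have hi' := notMem_range_of_mem_orthogonal b hi
        rcases i with i | i | i
        · exact (hi' ⟨.inl i, rfl⟩).elim
        · exact (hi' ⟨.inr i, rfl⟩).elim
        · exact hy (.inr (.inr i))
      rw [hquarter] at h1
      linarith
  · have h1 : ‖(Submodule.span ℝ (Set.range (b ∘ Sum.inl))).starProjection y‖ ≤
        n * (1 / (4 * n)) := by
      rw [← hcard]
      refine norm_starProjection_le_of_basis b _ (mem_span_or_mem_orthogonal b _)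
        (by positivity) fun i hi => ?_
      rw [hcard]
      obtain ⟨j, rfl⟩ := mem_range_of_mem_span_basis b hi
      exact hy (.inl j)
    rw [hquarter] at h1
    linarith
  · have h1 : ‖(Submodule.span ℝ (Set.range (b ∘ Sum.inl)))ᗮ.starProjection y‖ ≤
        n * (ρ / (4 * n)) := by
      rw [← hcard]
      refine norm_starProjection_le_of_basis b _ (fun i => ?_) (by positivity) fun i hi => ?_
      · rw [Submodule.orthogonal_orthogonal]; exact (mem_span_or_mem_orthogonal b _ i).symm
      rw [hcard]
      have hi' := notMem_range_of_mem_orthogonal b hi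
      rcases i with i | i | i
      · exact (hi' ⟨i, rfl⟩).elim
      · exact hy (.inr (.inl i))
      · exact (hy (.inr (.inr i))).trans (hle _ _ hδρ)
    rw [hquarter] at h1
    linarith

theorem sum_le_two_mul_of_halving (K : ℕ) (c : ℕ → ℝ) (h0 : ∀ k, 0 ≤ c k)
    (hc : ∀ k, c (k + 1) ≤ c k / 2) : ∑ k ∈ Finset.range K, c k ≤ 2 * c 0 := by
  induction K generalizing c with
  | zero => simpa using h0 0
  | succ K ih =>
    rw [Finset.sum_range_succ']
    have := ih (fun k => c (k + 1)) (fun k => h0 _) (fun k => hc _)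
    simp only [zero_add] at this
    linarith [hc 0]

/-- By the halving of coefficients, the sum at `y` is at most twice its first nonzero term. This
avoids cross terms in the norm of the extremal function. -/
theorem sq_sum_indicator_le {α : Type*} (K : ℕ) (c : ℕ → ℝ) (h0 : ∀ k, 0 ≤ c k)
    (hc : ∀ k, c (k + 1) ≤ c k / 2) (s : ℕ → Set α) (y : α) :
    (∑ k ∈ Finset.range K, (s k).indicator (fun _ => c k) y) ^ 2 ≤
      ∑ k ∈ Finset.range K, (s k).indicator (fun _ => 4 * c k ^ 2) y := by
  induction K generalizing c s with
  | zero => simp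
  | succ K ih =>
    rw [Finset.sum_range_succ', Finset.sum_range_succ' (fun k => (s k).indicator _ y)]
    have hnn : 0 ≤ ∑ k ∈ Finset.range K, (s (k + 1)).indicator (fun _ => c (k + 1)) y :=
      Finset.sum_nonneg fun k _ => Set.indicator_nonneg (fun _ _ => h0 _) y
    have hnn' : 0 ≤ ∑ k ∈ Finset.range K, (s (k + 1)).indicator (fun _ => 4 * c (k + 1) ^ 2) y :=
      Finset.sum_nonneg fun k _ => Set.indicator_nonneg (fun _ _ => by positivity) y
    by_cases hy : y ∈ s 0
    · rw [Set.indicator_of_mem hy, Set.indicator_of_mem hy]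
      have h1 : ∑ k ∈ Finset.range K, (s (k + 1)).indicator (fun _ => c (k + 1)) y ≤
          ∑ k ∈ Finset.range K, c (k + 1) :=
        Finset.sum_le_sum fun k _ => Set.indicator_le_self' (fun _ _ => h0 _) y
      have h2 := sum_le_two_mul_of_halving K (fun k => c (k + 1)) (fun k => h0 _) (fun k => hc _)
      simp only [zero_add] at h2
      have h3 := hc 0
      simp only [zero_add] at h3
      nlinarith [h0 0]
    · rw [Set.indicator_of_notMem hy, Set.indicator_of_notMem hy, add_zero, add_zero]
      exact ih (fun k => c (k + 1)) (fun k => h0 _) (fun k => hc _) (fun k => s (k + 1))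

/-- The extremal example: a dyadic version of `|Π y| ^ (-(n-d))`, where `Π` is the projection on
the orthogonal complement of a `(d-1)`-dimensional subspace. -/
theorem exists_nikodym_extremizer {d n l : ℕ} (hn : d + (1 + (l + 1)) = n) {δ : ℝ} (hδ : 0 < δ)
    {K : ℕ} (hK : ∀ k < K, 2 ^ k * δ ≤ 1) :
    ∃ f : EuclideanSpace ℝ (Fin n) → ℂ, MemLp f 2 volume ∧
      eLpNorm f 2 volume ≤
        ENNReal.ofReal (√(4 * 2 ^ n * ∑ k ∈ Finset.range K, 1 / (2 ^ k * δ) ^ l)) ∧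
      ∀ x ∈ Metric.ball (0 : EuclideanSpace ℝ (Fin n)) (1 / 4),
        ENNReal.ofReal ((1 / (4 * n)) ^ n * ∑ k ∈ Finset.range K, 1 / (2 ^ k * δ) ^ l) ≤
          nikodym (d + 1) n δ f x := by
  have hn0 : (0 : ℝ) < n := by exact_mod_cast (show 0 < n by omega)
  let b₀ : OrthonormalBasis (Fin d ⊕ (Unit ⊕ Fin (l + 1))) ℝ (EuclideanSpace ℝ (Fin n)) :=
    (stdOrthonormalBasis ℝ (EuclideanSpace ℝ (Fin n))).reindex
      (Fintype.equivOfCardEq (by simp [← hn]))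
  -- Here `d` is one less than the dimension of the plates, so `V` has codimension `l + 2`.
  set V := Submodule.span ℝ (Set.range (b₀ ∘ (Sum.inl : Fin d → _))) with hV
  have hVd : Module.finrank ℝ V = d := by
    rw [hV, finrank_span_basis b₀ Sum.inl_injective, Fintype.card_fin]
  -- With `r = 2 ^ k * δ`, the exponent balances both sides: `c k ^ 2 * r ^ (l + 2)` in the norm and
  -- `c k * r` in the average both equal `r ^ (-l)`.
  let c : ℕ → ℝ := fun k => 1 / (2 ^ k * δ) ^ (l + 1)
  let s : ℕ → Set (EuclideanSpace ℝ (Fin n)) := fun k => slab V 1 (2 ^ k * δ)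
  have hs : ∀ k, MeasurableSet (s k) := fun k => measurableSet_slab _ _ _
  have hc0 : ∀ k, 0 ≤ c k := fun k => by positivity
  have hc : ∀ k, c (k + 1) ≤ c k / 2 := fun k => by
    have h2 : (2 : ℝ) ≤ 2 ^ (l + 1) := by
      rw [pow_succ]; linarith [one_le_pow₀ (M₀ := ℝ) one_le_two (n := l)]
    simp only [c]
    rw [div_div]
    refine one_div_le_one_div_of_le (by positivity) ?_
    calc (2 ^ k * δ) ^ (l + 1) * 2 ≤ (2 ^ k * δ) ^ (l + 1) * 2 ^ (l + 1) := by gcongr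
      _ = _ := by rw [← mul_pow]; congr 1; ring
  let F : EuclideanSpace ℝ (Fin n) → ℝ := fun y =>
    ∑ k ∈ Finset.range K, (s k).indicator (fun _ => c k) y
  have hFm : Measurable F :=
    Finset.measurable_fun_sum _ fun k _ => measurable_const.indicator (hs k)
  have hF0 : ∀ y, 0 ≤ F y := fun y =>
    Finset.sum_nonneg fun k _ => Set.indicator_nonneg (fun _ _ => hc0 k) y
  have hen : ∀ y, ‖(F y : ℂ)‖ₑ = ENNReal.ofReal (F y) := fun y => by
    rw [← ofReal_norm, Complex.norm_real, Real.norm_of_nonneg (hF0 y)]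
  have hnorm : eLpNorm (fun y => (F y : ℂ)) 2 volume ≤
      ENNReal.ofReal (√(4 * 2 ^ n * ∑ k ∈ Finset.range K, 1 / (2 ^ k * δ) ^ l)) := by
    refine (ENNReal.pow_le_pow_left_iff two_ne_zero).1 ?_
    rw [← lintegral_enorm_sq_eq, ← ENNReal.ofReal_pow (by positivity),
      Real.sq_sqrt (by positivity)]
    calc ∫⁻ y, ‖(F y : ℂ)‖ₑ ^ 2
        ≤ ∫⁻ y, ∑ k ∈ Finset.range K, (s k).indicator (fun _ => ENNReal.ofReal (4 * c k ^ 2)) y := by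
          refine lintegral_mono fun y => ?_
          rw [hen, ← ENNReal.ofReal_pow (hF0 y)]
          refine (ENNReal.ofReal_le_ofReal (sq_sum_indicator_le K c hc0 hc s y)).trans ?_
          rw [ENNReal.ofReal_sum_of_nonneg fun k _ =>
            Set.indicator_nonneg (fun _ _ => by positivity) y]
          refine Finset.sum_le_sum fun k _ => ?_
          by_cases hy : y ∈ s k <;> simp [hy]
      _ = ∑ k ∈ Finset.range K, ENNReal.ofReal (4 * c k ^ 2) * volume (s k) := by
          rw [lintegral_finsetSum _ fun k _ => measurable_const.indicator (hs k)]
          exact Finset.sum_congr rfl fun k _ => lintegral_indicator_const (hs k) _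
      _ ≤ ∑ k ∈ Finset.range K, ENNReal.ofReal (4 * 2 ^ n * (1 / (2 ^ k * δ) ^ l)) := by
          refine Finset.sum_le_sum fun k _ => ?_
          refine (mul_le_mul_right (volume_slab_le hn hVd zero_le_one
            (by positivity)) _).trans ?_
          rw [← ENNReal.ofReal_mul (by positivity)]
          refine ENNReal.ofReal_le_ofReal (le_of_eq ?_)
          obtain ⟨r, hr, hr0⟩ : ∃ r : ℝ, r = 2 ^ k * δ ∧ 0 < r := ⟨_, rfl, by positivity⟩
          simp only [c]
          rw [← hr, one_pow]
          field_simp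
          ring
      _ = _ := by
          rw [← ENNReal.ofReal_sum_of_nonneg fun k _ => by positivity, Finset.mul_sum]
  refine ⟨fun y => (F y : ℂ), ⟨(Complex.measurable_ofReal.comp hFm).aestronglyMeasurable,
    hnorm.trans_lt ENNReal.ofReal_lt_top⟩, hnorm, fun x hx => ?_⟩
  obtain ⟨b, hb, hxb⟩ := exists_orthonormalBasis_mem_span b₀ x
  let τ : Gr (d + 1) n :=
    ⟨Submodule.span ℝ (Set.range (b ∘ (Sum.map id Sum.inl : Fin d ⊕ Unit → _))), by
      rw [finrank_span_basis b (Function.injective_id.sumMap Sum.inl_injective)]; simp⟩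
  refine le_trans ?_ (le_iSup _ τ)
  rw [setLAverage_eq]
  have hx' : ‖x‖ ≤ 1 / 4 := by simpa using (mem_ball_zero_iff.1 hx).le
  have hint : ENNReal.ofReal ((1 / (2 * n)) ^ n * δ ^ (l + 1) *
      ∑ k ∈ Finset.range K, 1 / (2 ^ k * δ) ^ l) ≤
        ∫⁻ y in x +ᵥ plate δ τ, ‖(F y : ℂ)‖ₑ := by
    calc _ = ∑ k ∈ Finset.range K, ENNReal.ofReal (c k) *
          ENNReal.ofReal ((1 / (2 * n)) ^ n * ((2 ^ k * δ) * δ ^ (l + 1))) := by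
          rw [Finset.mul_sum, ENNReal.ofReal_sum_of_nonneg fun k _ => by positivity]
          refine Finset.sum_congr rfl fun k _ => ?_
          rw [← ENNReal.ofReal_mul (hc0 k)]
          congr 1
          obtain ⟨r, hr, hr0⟩ : ∃ r : ℝ, r = 2 ^ k * δ ∧ 0 < r := ⟨_, rfl, by positivity⟩
          simp only [c]
          rw [← hr, pow_succ r]
          field_simp
      _ ≤ ∑ k ∈ Finset.range K, ENNReal.ofReal (c k) * volume (s k ∩ (x +ᵥ plate δ τ)) := by
          refine Finset.sum_le_sum fun k hk => ?_
          gcongr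
          rw [Set.inter_comm]
          have h1k : (1 : ℝ) ≤ 2 ^ k := one_le_pow₀ one_le_two
          have := le_volume_inter_slab hn hδ (ρ := 2 ^ k * δ) (by nlinarith)
            (hK k (Finset.mem_range.1 hk)) b (τ := τ) rfl hxb hx'
          rwa [hb] at this
      _ = ∫⁻ y in x +ᵥ plate δ τ, ∑ k ∈ Finset.range K,
            (s k).indicator (fun _ => ENNReal.ofReal (c k)) y := by
          rw [lintegral_finsetSum _ fun k _ => measurable_const.indicator (hs k)]
          refine Finset.sum_congr rfl fun k _ => ?_
          rw [lintegral_indicator_const (hs k), Measure.restrict_apply (hs k)]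
      _ = _ := by
          refine lintegral_congr fun y => ?_
          rw [hen, ENNReal.ofReal_sum_of_nonneg fun k _ =>
            Set.indicator_nonneg (fun _ _ => hc0 k) y]
          refine Finset.sum_congr rfl fun k _ => ?_
          by_cases hy : y ∈ s k <;> simp [hy]
  have hV2 := volume_vadd_plate_le (m := l + 1) (by omega) hδ τ x
  have hpos : (0 : ℝ) < 2 ^ n * δ ^ (l + 1) := by positivity
  calc _ = ENNReal.ofReal ((1 / (2 * n)) ^ n * δ ^ (l + 1) *
      ∑ k ∈ Finset.range K, 1 / (2 ^ k * δ) ^ l) / ENNReal.ofReal (2 ^ n * δ ^ (l + 1)) := by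
        rw [← ENNReal.ofReal_div_of_pos hpos]
        congr 1
        have : (1 / (4 * (n : ℝ))) ^ n = (1 / (2 * n)) ^ n / 2 ^ n := by
          rw [← div_pow]; congr 1; field_simp; norm_num
        rw [this]
        generalize ∑ k ∈ Finset.range K, 1 / (2 ^ k * δ) ^ l = Λ
        field_simp
    _ ≤ _ := ENNReal.div_le_div hint hV2

/-- A single lower bound on a fixed ball tests both norms: directly for the weak one, by Chebyshev
for the strong one. -/
theorem le_nikodymNorms {d n l : ℕ} (hn : d + (1 + (l + 1)) = n) {δ : ℝ} (hδ : 0 < δ)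
    {K : ℕ} (hK0 : 0 < K) (hK : ∀ k < K, 2 ^ k * δ ≤ 1) :
    ENNReal.ofReal ((1 / (4 * n)) ^ n / 2 * √((1 / 4) ^ n * unitBallVolume n) / √(4 * 2 ^ n) *
        √(∑ k ∈ Finset.range K, 1 / (2 ^ k * δ) ^ l)) ≤
      min (nikodymWeakNorm (d + 1) n δ) (nikodymStrongNorm (d + 1) n δ) := by
  have hn0 : (0 : ℝ) < n := by exact_mod_cast (show 0 < n by omega)
  have hβ := unitBallVolume_pos n
  obtain ⟨f, hf, hnorm, hlow⟩ := exists_nikodym_extremizer hn hδ hK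
  obtain ⟨Λ, hΛ⟩ : ∃ Λ : ℝ, Λ = ∑ k ∈ Finset.range K, 1 / (2 ^ k * δ) ^ l := ⟨_, rfl⟩
  have hΛ0 : 0 < Λ := by
    rw [hΛ]
    exact Finset.sum_pos (fun k _ => by positivity) ⟨0, Finset.mem_range.2 hK0⟩
  rw [← hΛ] at hnorm hlow ⊢
  -- Half the guaranteed value, because the level sets are defined by a strict inequality.
  set t : ℝ≥0 := ⟨(1 / (4 * n)) ^ n / 2 * Λ, by positivity⟩ with ht
  have htr : (t : ℝ) = (1 / (4 * n)) ^ n / 2 * Λ := rfl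
  set E := Metric.ball (0 : EuclideanSpace ℝ (Fin n)) (1 / 4) with hE
  have hlt : ∀ x ∈ E, (t : ℝ≥0∞) < nikodym (d + 1) n δ f x := fun x hx => by
    refine lt_of_lt_of_le ?_ (hlow x hx)
    rw [← ENNReal.ofReal_coe_nnreal, htr]
    refine (ENNReal.ofReal_lt_ofReal_iff (by positivity)).2 ?_
    have : 0 < (1 / (4 * (n : ℝ))) ^ n * Λ := by positivity
    linarith
  have hval : (t : ℝ≥0∞) * volume E ^ (1 / 2 : ℝ) = ENNReal.ofReal
      ((1 / (4 * n)) ^ n / 2 * Λ * √((1 / 4) ^ n * unitBallVolume n)) := by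
    rw [hE, volume_ball_eq _ (by norm_num), ENNReal.ofReal_rpow_of_nonneg (by positivity)
      (by norm_num), ← Real.sqrt_eq_rpow, ← ENNReal.ofReal_coe_nnreal, htr,
      ← ENNReal.ofReal_mul (by positivity)]
  have hfinal : ∀ A : ℝ≥0∞, (t : ℝ≥0∞) * volume E ^ (1 / 2 : ℝ) ≤ A * eLpNorm f 2 volume →
      ENNReal.ofReal ((1 / (4 * n)) ^ n / 2 * √((1 / 4) ^ n * unitBallVolume n) / √(4 * 2 ^ n) *
        √Λ) ≤ A := by
    intro A hA
    have h1 : (t : ℝ≥0∞) * volume E ^ (1 / 2 : ℝ) ≤ A * ENNReal.ofReal (√(4 * 2 ^ n * Λ)) :=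
      hA.trans (by gcongr)
    have hpos : 0 < √(4 * 2 ^ n * Λ) := by positivity
    rw [hval] at h1
    refine le_trans (le_of_eq ?_) (ENNReal.div_le_of_le_mul h1)
    rw [← ENNReal.ofReal_div_of_pos hpos]
    congr 1
    rw [Real.sqrt_mul (x := 4 * 2 ^ n) (by positivity) Λ]
    field_simp
    rw [Real.sq_sqrt hΛ0.le]
  refine le_min (le_sInf fun A hA => hfinal A ?_) (le_sInf fun A hA => hfinal A ?_)
  · refine le_trans ?_ (hA f hf)
    refine le_trans ?_ (le_iSup (fun t : ℝ≥0 => (t : ℝ≥0∞) *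
      volume {x | (t : ℝ≥0∞) < nikodym (d + 1) n δ f x} ^ (1 / 2 : ℝ)) t)
    gcongr
    exact hlt
  · refine le_trans ?_ (hA f hf)
    refine (ENNReal.pow_le_pow_left_iff two_ne_zero).1 ?_
    rw [← lintegral_enorm_sq_eq, mul_pow, ← ENNReal.rpow_two (volume E ^ _), ← ENNReal.rpow_mul]
    norm_num
    rw [← setLIntegral_const]
    refine (setLIntegral_mono' measurableSet_ball fun x hx => ?_).trans (setLIntegral_le_lintegral E _)
    gcongr
    exact (hlt x hx).le

/-! ### Rates, number of scales, and conclusion. -/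

/-- The square of `weakRate`, as a function of `l = n - d - 1`. -/
noncomputable def sqRate (l : ℕ) (δ : ℝ) : ℝ := if 0 < l then (1 / δ) ^ l else Real.log δ⁻¹

theorem half_le_log_inv {δ : ℝ} (hδ : 0 < δ) (hδ1 : δ ≤ 1 / 2) : 1 / 2 ≤ Real.log δ⁻¹ := by
  have h1 : (2 : ℝ) ≤ δ⁻¹ := by rw [le_inv_comm₀ two_pos hδ]; linarith
  have h2 := Real.log_le_log two_pos h1
  linarith [Real.log_two_gt_d9]

theorem half_le_sqRate (l : ℕ) {δ : ℝ} (hδ : 0 < δ) (hδ1 : δ ≤ 1 / 2) : 1 / 2 ≤ sqRate l δ := by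
  unfold sqRate
  split_ifs with h
  · have : (1 : ℝ) ≤ 1 / δ := by rw [le_div_iff₀ hδ]; linarith
    linarith [one_le_pow₀ this (n := l)]
  · exact half_le_log_inv hδ hδ1

theorem weakRate_eq {d n l : ℕ} (hn : d + (l + 1) = n) {δ : ℝ} (hδ : 0 < δ) :
    weakRate d n δ = √(sqRate l δ) := by
  unfold weakRate sqRate
  by_cases h : 0 < l
  · rw [if_pos (by omega), if_pos h, ← hn, Real.sqrt_eq_rpow, ← Real.rpow_natCast,
      ← Real.rpow_mul (by positivity), one_div, Real.inv_rpow hδ.le, ← Real.rpow_neg hδ.le]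
    congr 1
    push_cast; ring
  · rw [if_neg (by omega), if_neg h]

theorem strongRate_eq {d n l : ℕ} (hn : d + (l + 1) = n) {δ : ℝ} (hδ : 0 < δ) (hδ1 : δ ≤ 1 / 2) :
    strongRate d n δ = √(sqRate l δ) * √(Real.log δ⁻¹) := by
  rw [← weakRate_eq hn hδ]
  unfold strongRate weakRate
  split_ifs with h
  · rfl
  · rw [Real.mul_self_sqrt (by linarith [half_le_log_inv hδ hδ1])]

theorem geom_sum_le_two_mul {q : ℝ} (hq : 2 ≤ q) (K : ℕ) :
    ∑ k ∈ Finset.range (K + 1), q ^ k ≤ 2 * q ^ K := by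
  induction K with
  | zero => simp
  | succ K ih =>
    rw [Finset.sum_range_succ]
    have : (0 : ℝ) ≤ q ^ K := by positivity
    nlinarith [pow_succ q K]

/-- The number of dyadic scales between `δ` and a constant, with the corresponding bound on the
sum over scales. -/
theorem exists_scales (l : ℕ) {δ : ℝ} (hδ : 0 < δ) (hδ1 : δ ≤ 1 / 2) :
    ∃ K : ℕ, 3 < 2 ^ K * δ ∧
      ∑ k ∈ Finset.range (K + 1), ((2 : ℝ) ^ l) ^ k ≤ (10 + 2 * 6 ^ l) * sqRate l δ := by
  have hex : ∃ K : ℕ, 3 < 2 ^ K * δ := by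
    obtain ⟨K, hK⟩ := pow_unbounded_of_one_lt (3 / δ) one_lt_two
    exact ⟨K, by rwa [div_lt_iff₀ hδ] at hK⟩
  classical
  refine ⟨Nat.find hex, Nat.find_spec hex, ?_⟩
  set K := Nat.find hex with hKdef
  -- By minimality of `K`, the previous power satisfies `2 ^ (K - 1) * δ ≤ 3`.
  have hle : (2 : ℝ) ^ K ≤ 6 / δ := by
    rcases hK : K with _ | j
    · rw [pow_zero, le_div_iff₀ hδ]; linarith
    · have := not_lt.1 (Nat.find_min hex (m := j) (by omega))
      rw [le_div_iff₀ hδ, pow_succ]; linarith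
  have hR := half_le_sqRate l hδ hδ1
  rcases Nat.eq_zero_or_pos l with rfl | hl
  · have hR' : sqRate 0 δ = Real.log δ⁻¹ := by simp [sqRate]
    have h1 := Real.log_le_log (by positivity) hle
    rw [Real.log_pow, div_eq_mul_inv, Real.log_mul (by norm_num) (by positivity), ← hR'] at h1
    have h2 : Real.log 6 ≤ 3 * Real.log 2 := by
      rw [show 3 * Real.log 2 = Real.log (2 ^ 3) by rw [Real.log_pow]; norm_num]
      exact Real.log_le_log (by norm_num) (by norm_num)
    have h3 : Real.log 2 ≤ sqRate 0 δ := by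
      rw [hR']
      exact Real.log_le_log two_pos (by rw [le_inv_comm₀ two_pos hδ]; linarith)
    have h4 := Real.log_two_gt_d9
    have h5 : (0 : ℝ) ≤ K := Nat.cast_nonneg K
    simp only [pow_zero, one_pow, Finset.sum_const, Finset.card_range, nsmul_eq_mul, mul_one]
    push_cast
    nlinarith
  · have hq : (2 : ℝ) ≤ 2 ^ l := by
      calc (2 : ℝ) = 2 ^ 1 := (pow_one 2).symm
        _ ≤ 2 ^ l := pow_le_pow_right₀ one_le_two hl
    refine (geom_sum_le_two_mul hq K).trans ?_
    have h1 : ((2 : ℝ) ^ l) ^ K ≤ 6 ^ l * sqRate l δ := by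
      rw [← pow_mul, mul_comm, pow_mul]
      refine (pow_le_pow_left₀ (by positivity) hle l).trans (le_of_eq ?_)
      rw [sqRate, if_pos hl, ← mul_pow]; congr 1; ring
    nlinarith

theorem exists_levels {n : ℕ} (hn0 : 0 < n) (m : ℕ) {δ : ℝ} (hδ : 0 < δ) (hδ1 : δ ≤ 1 / 2) :
    ∃ Q : ℕ, 1 ≤ 4 ^ Q * ((1 / n) ^ n * δ ^ m) ∧
      (Q : ℝ) ≤ (2 * (n * Real.log n) + m + 2) * Real.log δ⁻¹ := by
  have hn' : (1 : ℝ) ≤ n := by exact_mod_cast hn0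
  have hL := half_le_log_inv hδ hδ1
  have hlogn : 0 ≤ n * Real.log n := by have := Real.log_nonneg hn'; positivity
  have hw : (0 : ℝ) ≤ n * Real.log n + m * Real.log δ⁻¹ := by positivity
  -- The logarithm of `n ^ n * δ⁻¹ ^ m`; natural logarithms suffice because `log 4 ≥ 1`.
  refine ⟨⌈n * Real.log n + m * Real.log δ⁻¹⌉₊, ?_, ?_⟩
  · set Q := ⌈n * Real.log n + m * Real.log δ⁻¹⌉₊
    have h1 : (n : ℝ) ^ n * (δ⁻¹) ^ m ≤ 4 ^ Q := by
      rw [← Real.log_le_log_iff (by positivity) (by positivity),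
        Real.log_mul (by positivity) (by positivity), Real.log_pow, Real.log_pow, Real.log_pow]
      refine (Nat.le_ceil _).trans (le_mul_of_one_le_right (Nat.cast_nonneg _) ?_)
      rw [show (4 : ℝ) = 2 ^ 2 by norm_num, Real.log_pow]
      push_cast
      linarith [Real.log_two_gt_d9]
    calc (1 : ℝ) = (n : ℝ) ^ n * (δ⁻¹) ^ m * ((1 / n) ^ n * δ ^ m) := by
          have : (n : ℝ) ≠ 0 := by positivity
          rw [one_div, inv_pow, inv_pow]
          field_simp
      _ ≤ _ := by gcongr
  · refine (Nat.ceil_lt_add_one hw).le.trans ?_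
    nlinarith

/-- For `0 < l` the term `k = 0` alone suffices; for `l = 0` every term is 1 and their number is at
least `log δ⁻¹`. -/
theorem exists_lower_scales (l : ℕ) {δ : ℝ} (hδ : 0 < δ) (hδ1 : δ ≤ 1 / 2) :
    ∃ K : ℕ, 0 < K ∧ (∀ k < K, 2 ^ k * δ ≤ 1) ∧
      sqRate l δ ≤ ∑ k ∈ Finset.range K, 1 / (2 ^ k * δ) ^ l := by
  have hex : ∃ K : ℕ, 1 < 2 ^ K * δ := by
    obtain ⟨K, hK⟩ := pow_unbounded_of_one_lt (1 / δ) one_lt_two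
    exact ⟨K, by rwa [div_lt_iff₀ hδ] at hK⟩
  classical
  have hK0 : 0 < Nat.find hex := by
    rw [Nat.find_pos]; simp; linarith
  refine ⟨Nat.find hex, hK0, fun k hk => not_lt.1 (Nat.find_min hex hk), ?_⟩
  have hspec := Nat.find_spec hex
  set K := Nat.find hex
  rcases Nat.eq_zero_or_pos l with rfl | hl
  · have h1 : δ⁻¹ ≤ 2 ^ K := by rw [inv_le_iff_one_le_mul₀ hδ]; exact hspec.le
    have h2 := Real.log_le_log (by positivity) h1
    rw [Real.log_pow] at h2
    have h3 := Real.log_two_lt_d9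
    have h5 : (0 : ℝ) ≤ K := Nat.cast_nonneg K
    simp [sqRate]
    rw [Real.log_inv] at h2
    nlinarith
  · refine le_trans (le_of_eq ?_) (Finset.single_le_sum
      (f := fun k : ℕ => 1 / ((2 : ℝ) ^ k * δ) ^ l) (fun k _ => by positivity)
      (Finset.mem_range.2 hK0))
    simp [sqRate, hl]

theorem theorem1p3 (d n : ℕ) (hd : 1 ≤ d) (hdn : d < n) :
    ∃ c C : ℝ, 0 < c ∧ 0 < C ∧ ∀ δ : ℝ, 0 < δ → δ ≤ 1 / 2 →
      -- the weak (2,2) bound, and its sharpness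
      nikodymWeakNorm d n δ ≤ ENNReal.ofReal (C * weakRate d n δ) ∧
      ENNReal.ofReal (c * weakRate d n δ) ≤ nikodymWeakNorm d n δ ∧
      -- the strong (2,2) bound, and its sharpness up to the factor `√(log δ⁻¹)`
      nikodymStrongNorm d n δ ≤ ENNReal.ofReal (C * strongRate d n δ) ∧
      ENNReal.ofReal (c * (strongRate d n δ / √(Real.log δ⁻¹))) ≤ nikodymStrongNorm d n δ := by
  obtain ⟨k, rfl⟩ : ∃ k, d = k + 1 := ⟨d - 1, by omega⟩
  obtain ⟨l, hn⟩ : ∃ l, k + 1 + (l + 1) = n := ⟨n - k - 2, by omega⟩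
  have hn0 : 0 < n := by omega
  have hn0' : (0 : ℝ) < n := by exact_mod_cast hn0
  have hβ := unitBallVolume_pos n
  have hW := weakConst_pos (d := k + 1) (l := l) hn0
  have hlogn : 0 ≤ n * Real.log n := by
    have := Real.log_nonneg (show (1 : ℝ) ≤ n by exact_mod_cast hn0)
    positivity
  set X := unitBallVolume n * weakConst (k + 1) n l * (10 + 2 * 6 ^ l) with hX
  set M := 2 * (n * Real.log n) + (l + 1 : ℕ) + 2 with hM
  have hX0 : 0 < X := by positivity
  have hM0 : 0 < M := by positivity
  set Y := 3 ^ n * (4 * unitBallVolume n + 4 * M * X) with hY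
  have hY0 : 0 < Y := by positivity
  refine ⟨(1 / (4 * n)) ^ n / 2 * √((1 / 4) ^ n * unitBallVolume n) / √(4 * 2 ^ n),
    √X + √Y, by positivity, by positivity, fun δ hδ hδ1 => ?_⟩
  have hL := half_le_log_inv hδ hδ1
  have hR := half_le_sqRate l hδ hδ1
  rw [strongRate_eq hn hδ hδ1, weakRate_eq hn hδ]
  have hsL : 0 < √(Real.log δ⁻¹) := Real.sqrt_pos.2 (by linarith)
  rw [mul_div_cancel_right₀ _ hsL.ne']
  set R := sqRate l δ
  set D := Real.log δ⁻¹
  obtain ⟨K, hK, hKR⟩ := exists_scales l hδ hδ1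
  obtain ⟨Q, hQ, hQD⟩ := exists_levels hn0 (l + 1) hδ hδ1
  obtain ⟨K', hK0', hK', hKR'⟩ := exists_lower_scales l hδ hδ1
  have hsum : unitBallVolume n * weakConst (k + 1) n l *
      (∑ k ∈ Finset.range (K + 1), ((2 : ℝ) ^ l) ^ k) ≤ X * R := by
    rw [hX, mul_assoc (unitBallVolume n * _)]
    gcongr
  have hlow : ENNReal.ofReal ((1 / (4 * n)) ^ n / 2 * √((1 / 4) ^ n * unitBallVolume n) /
      √(4 * 2 ^ n) * √R) ≤
        min (nikodymWeakNorm (k + 1) n δ) (nikodymStrongNorm (k + 1) n δ) := by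
    refine le_trans (ENNReal.ofReal_le_ofReal ?_)
      (le_nikodymNorms (d := k) (l := l) (by omega) hδ hK0' hK')
    gcongr
  refine ⟨?_, hlow.trans (min_le_left _ _), ?_, hlow.trans (min_le_right _ _)⟩
  · refine (nikodymWeakNorm_le hn hδ hδ1 hK).trans (ENNReal.ofReal_le_ofReal ?_)
    calc _ ≤ √(X * R) := Real.sqrt_le_sqrt hsum
      _ = √X * √R := Real.sqrt_mul hX0.le _
      _ ≤ _ := by gcongr; linarith [Real.sqrt_nonneg Y]
  · refine (nikodymStrongNorm_le hn hδ hδ1 hK hQ).trans (ENNReal.ofReal_le_ofReal ?_)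
    -- Both `R` and `D` are at least `1 / 2`, so the contribution of the low values is absorbed into
    -- `R * D`; this is the 4 in front of the ball volume in `Y`.
    have hRD : 1 ≤ 4 * (R * D) := by nlinarith
    have hin : 3 ^ n * (unitBallVolume n + 4 * Q * (unitBallVolume n * weakConst (k + 1) n l *
        (∑ k ∈ Finset.range (K + 1), ((2 : ℝ) ^ l) ^ k))) ≤ Y * (R * D) := by
      calc _ ≤ 3 ^ n * (unitBallVolume n * (4 * (R * D)) + 4 * (M * D) * (X * R)) := by
            gcongr
            exact le_mul_of_one_le_right hβ.le hRD
        _ = _ := by rw [hY]; ring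
    calc _ ≤ √(Y * (R * D)) := Real.sqrt_le_sqrt hin
      _ = √Y * (√R * √D) := by
        rw [Real.sqrt_mul (x := Y) hY0.le, Real.sqrt_mul (x := R) (by linarith)]
      _ ≤ _ := by gcongr; linarith [Real.sqrt_nonneg X]
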